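/- **Setting.** All spacetimes are 4-dimensional, smooth, Hausdorff, of signature $(+,-,-,-)$; $\nabla$ is the Levi-Civita connection, $L_{ij}=\tfrac12(R_{ij}-\tfrac16Rg_{ij})$ the Schouten tensor, $L=g^{ij}L_{ij}$, $G_{ij}$ the Einstein tensor. For a metric $g$, a scalar field $f$, $\epsilon=\pm1$ and $\mu\in\mathbb R$ the energy-momentum tensor $T^{[f]}_{ij}$ of the conformal scalar field $f$ with quartic coefficient $\mu$ is $$\epsilon\,T^{[f]}_{ij}=4\nabla_if\nabla_jf-g_{ij}\nabla^kf\nabla_kf-2f\nabla_i\nabla_jf+2f^2L_{ij}-2\mu f^4g_{ij}.$$ **Physical spacetime.** Let $(\hat M,\hat g)$ with a smooth scalar field $\hat\phi$ satisfy, for some $\epsilon=\pm1$ and $\lambda,\mu\in\mathbb R$, $$\hat G_{ij}+6\lambda\hat g_{ij}=\hat T_{ij}:=\hat T^{[\hat\phi]}_{ij}+\hat T^{[\mathcal M]}_{ij},\qquad \hat\square\hat\phi-\hat L\hat\phi=-4\mu\hat\phi^3,$$ where $\hat T^{[\hat\phi]}$ is formed with the coefficient $\mu$ and $\hat T^{[\mathcal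 M]}$ is the energy-momentum tensor of further matter: any smooth symmetric, trace-free and divergence-free tensor field, in particular that of a Yang–Mills field together with a radiation fluid (each attractive or repulsive), or $\hat T^{[\mathcal M]}=0$ (no further matter). Assume that $\hat\phi$ does not vanish identically on any nonempty open set. **Conformal boundary.** Let $(\hat M,\hat g)$ be weakly asymptotically flat, conformally embedded in $(M,g)$: $\hat M$ is an open subset of $M$, $g$ is a smooth Lorentzian metric on $M$, and there is a smooth function $\hat\theta$ on $M$ with $g=\hat\theta^2\hat g$ and $\hat\theta>0$ on $\hat M$, while $\hat\theta=0$ and $d\hat\theta\neq0$ on the (nonempty) boundary $\Sigma=\partial\hat M$ of $\hat M$ in $M$. Let this conformal boundary $\Sigma$ be a spacelike hypersurface of $(M,g)$. The *dual spacetime* $(\check M,\check g)$ is $\check M=\{x\in\hat M:\hat\phi(x)\ne0\}$ with $\check g=\hat\phi^2\hat g$. **Isotropic singularity.** $\Sigma$ is an *isotropic singularity* of $(\check M,\check g)$ if $\Sigma$ is a nonempty spacelike hypersurface of $(M,g)$ with a smooth (regular) Lorentzian metric $g$ on $M$, $\check M$ is open in $M$, $\Sigma\subset\overline{\check M}\setminus\check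 M$, $\check g=\Xi^2g$ is a smooth Lorentzian metric on $\check M$ with a smooth nowhere vanishing $\Xi$ on $\check M$ that extends continuously by $0$ to $\Sigma$, and the curvature of $\check g$ blows up at $\Sigma$: for each $p\in\Sigma$, in every coordinate system of $M$ around $p$, the components of the Ricci tensor of $\check g$ are unbounded on $\mathcal U\cap\check M$ for every neighbourhood $\mathcal U$ of $p$, and unbounded along every $C^1$ curve $\gamma:[0,1]\to M$ with $\gamma([0,1))\subset\check M$, $\gamma(1)=p$, as the parameter tends to $1$. **Claim.** Suppose that $\hat\Phi=\hat\phi/\hat\theta$ extends continuously to $\hat M\cup\Sigma$ and vanishes on $\Sigma$, and that $T_{ij}=\hat\theta^{-2}\hat T_{ij}$ is finite and non-vanishing on $\Sigma$, i.e. extends continuously to $\hat M\cup\Sigma$ with $T\ne0$ at every point of $\Sigma$. Then: 1. $\Sigma$ is an isotropic singularity of the dual spacetime $(\check M,\check g)$. 2. If there is no further matter ($\hat T^{[\mathcal M]}=0$), then at every $p\in\Sigma$ the Ricci tensor of $\check g$ diverges: in every coordinate system of $M$ around $p$, $\sum_{i,j}|\check R_{ij}(x)|\to\infty$ as $x\to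 p$ in $\check M$. 3. With further matter, the same divergence holds, in every coordinate system around $p$, at every $p\in\Sigma$ at which the components of the scalar part $\hat\theta^{-2}\hat T^{[\hat\phi]}_{ij}$ have finite limits (as $x\to p$ in $\hat M$) that are not all zero. 4. In all cases the energy-momentum tensor $\check T^{[\check\phi]}_{ij}$ of the dual scalar field $\check\phi=\hat\phi^{-1}$ on $(\check M,\check g)$, formed with the coefficient $\lambda$ and the same $\epsilon$, diverges at $\Sigma$: at every $p\in\Sigma$ and in every coordinate system of $M$ around $p$, $\sum_{i,j}|\check T^{[\check\phi]}_{ij}(x)|\to\infty$ as $x\to p$ in $\check M$. -/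

import Mathlib

open Set Filter Topology
open scoped Manifold ContDiff

noncomputable section

namespace CCC

/-! ## Tensor calculus in local coordinates

Signature `(+,-,-,-)`, four dimensions.  Component functions of tensor fields in a local
coordinate system are functions on (an open subset of) `ℝ⁴`. -/

/-- The model space `ℝ⁴`. -/
abbrev E4 := EuclideanSpace ℝ (Fin 4)

/-- The coordinate basis vector `∂ᵢ` of `ℝ⁴`. -/
def basisVec (i : Fin 4) : E4 := EuclideanSpace.single i (1 : ℝ)

/-- The partial derivative `∂ᵢ f`. -/
def pd (i : Fin 4) (f : E4 → ℝ) (y : E4) : ℝ := fderiv ℝ f y (basisVec i)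

/-- Component functions of a covariant 2-tensor in a coordinate system. -/
abbrev Comp2 := Fin 4 → Fin 4 → E4 → ℝ

/-- Component functions of a covector field in a coordinate system. -/
abbrev Comp1 := Fin 4 → E4 → ℝ

/-- The inverse metric `g^{ij}`. -/
def ginv (g : Comp2) (i j : Fin 4) (y : E4) : ℝ :=
  (Matrix.of fun a b => g a b y)⁻¹ i j

/-- The Christoffel symbols `Γ^k_{ij}`. -/
def christoffel (g : Comp2) (k i j : Fin 4) (y : E4) : ℝ :=
  (1 / 2) * ∑ l, ginv g k l y * (pd i (g l j) y + pd j (g l i) y - pd l (g i j) y)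

/-- The Ricci tensor `R_{jl} = R_{kj}{}^k{}_l`, where
`(∇_i ∇_j - ∇_j ∇_i) v^k = R_{ij}{}^k{}_l v^l`. -/
def ricci (g : Comp2) (j l : Fin 4) (y : E4) : ℝ :=
  ∑ k, (pd k (christoffel g k j l) y - pd j (christoffel g k k l) y
    + ∑ m, (christoffel g k k m y * christoffel g m j l y
      - christoffel g k j m y * christoffel g m k l y))

/-- The trace `g^{ij} t_{ij}`. -/
def trace (g t : Comp2) (y : E4) : ℝ := ∑ i, ∑ j, ginv g i j y * t i j y

/-- The scalar curvature `R`. -/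
def scalarCurv (g : Comp2) : E4 → ℝ := trace g (ricci g)

/-- The Schouten tensor `L_{ij} = (R_{ij} - R g_{ij} / 6) / 2`. -/
def schouten (g : Comp2) (i j : Fin 4) (y : E4) : ℝ :=
  (1 / 2) * (ricci g i j y - (1 / 6) * scalarCurv g y * g i j y)

/-- The Einstein tensor `G_{ij} = R_{ij} - R g_{ij} / 2`. -/
def einstein (g : Comp2) (i j : Fin 4) (y : E4) : ℝ :=
  ricci g i j y - (1 / 2) * scalarCurv g y * g i j y

/-- The covariant Hessian `∇_i ∇_j f`. -/
def hess (g : Comp2) (f : E4 → ℝ) (i j : Fin 4) (y : E4) : ℝ :=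
  pd i (pd j f) y - ∑ k, christoffel g k i j y * pd k f y

/-- The squared gradient `∇^k f ∇_k f`. -/
def gradSq (g : Comp2) (f : E4 → ℝ) (y : E4) : ℝ :=
  ∑ i, ∑ j, ginv g i j y * pd i f y * pd j f y

/-- The covariant derivative `∇_k t_{ij}` of a 2-tensor. -/
def covDeriv2 (g t : Comp2) (k i j : Fin 4) (y : E4) : ℝ :=
  pd k (t i j) y - ∑ l, christoffel g l k i y * t l j y - ∑ l, christoffel g l k j y * t i l y

/-- The divergence `∇^i t_{ij}`. -/
def divergence (g t : Comp2) (j : Fin 4) (y : E4) : ℝ :=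
  ∑ k, ∑ i, ginv g k i y * covDeriv2 g t k i j y

/-- The energy-momentum tensor `T_{ij}` of a conformal scalar field `f` with quartic coefficient
`mu`, given by
`ε T_{ij} = 4 ∇_i f ∇_j f - g_{ij} ∇^k f ∇_k f - 2 f ∇_i ∇_j f + 2 f² L_{ij} - 2 mu f⁴ g_{ij}`
with `ε = ± 1` (so that `ε⁻¹ = ε`). -/
def scalarEMT (ε mu : ℝ) (g : Comp2) (f : E4 → ℝ) (i j : Fin 4) (y : E4) : ℝ :=
  ε * (4 * pd i f y * pd j f y - g i j y * gradSq g f y - 2 * f y * hess g f i j y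
    + 2 * f y ^ 2 * schouten g i j y - 2 * mu * f y ^ 4 * g i j y)

/-- The conformally invariant wave equation `□ f - L f = - 4 mu f³`, where `L = g^{ij} L_{ij}`. -/
def WaveEq (mu : ℝ) (g : Comp2) (f : E4 → ℝ) (y : E4) : Prop :=
  trace g (hess g f) y - trace g (schouten g) y * f y = - 4 * mu * f y ^ 3

/-! ## Tensor fields on a manifold -/

variable {M : Type*} [TopologicalSpace M] [ChartedSpace E4 M]

/-- (Not necessarily continuous) covariant 2-tensor fields on `M`. -/
abbrev TensorField2 (M : Type*) [TopologicalSpace M] [ChartedSpace E4 M] :=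
  (x : M) → TangentSpace (𝓡 4) x →L[ℝ] TangentSpace (𝓡 4) x →L[ℝ] ℝ

/-- (Not necessarily continuous) covector fields on `M`. -/
abbrev CovectorField (M : Type*) [TopologicalSpace M] [ChartedSpace E4 M] :=
  (x : M) → TangentSpace (𝓡 4) x →L[ℝ] ℝ

/-- The smooth local coordinate systems of `M`. -/
abbrev Charts (M : Type*) [TopologicalSpace M] [ChartedSpace E4 M] :
    Set (OpenPartialHomeomorph M E4) :=
  IsManifold.maximalAtlas (𝓡 4) ∞ M

/-- The coordinate vector field `∂ᵢ` of the coordinate system `e`, at the point with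
coordinates `y`. -/
def coordVec (e : OpenPartialHomeomorph M E4) (i : Fin 4) (y : E4) :
    TangentSpace (𝓡 4) (e.symm y) :=
  mfderiv (𝓡 4) (𝓡 4) e.symm y (basisVec i)

/-- The components `t_{ij} = t(∂ᵢ, ∂ⱼ)` of a 2-tensor field in the coordinate system `e`. -/
def comp2 (t : TensorField2 M) (e : OpenPartialHomeomorph M E4) : Comp2 :=
  fun i j y => t (e.symm y) (coordVec e i y) (coordVec e j y)

/-- The components `a_i = a(∂ᵢ)` of a covector field in the coordinate system `e`. -/
def comp1 (a : CovectorField M) (e : OpenPartialHomeomorph M E4) : Comp1 :=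
  fun i y => a (e.symm y) (coordVec e i y)

/-- The coordinate expression of a function in the coordinate system `e`. -/
def comp0 (f : M → ℝ) (e : OpenPartialHomeomorph M E4) : E4 → ℝ := fun y => f (e.symm y)

/-- The coordinates of those points of `S` that lie in the domain of `e`. -/
def region (e : OpenPartialHomeomorph M E4) (S : Set M) : Set E4 := e.target ∩ e.symm ⁻¹' S

/-- Smoothness of a 2-tensor field on a set. -/
def Smooth2On (t : TensorField2 M) (U : Set M) : Prop :=
  ∀ e ∈ Charts M, ∀ i j, ContDiffOn ℝ ∞ (comp2 t e i j) (region e U)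

/-- Continuity of a 2-tensor field on a set. -/
def Continuous2On (t : TensorField2 M) (S : Set M) : Prop :=
  ∀ e ∈ Charts M, ∀ i j, ContinuousOn (comp2 t e i j) (region e S)

/-- Smoothness of a covector field on a set. -/
def Smooth1On (a : CovectorField M) (U : Set M) : Prop :=
  ∀ e ∈ Charts M, ∀ i, ContDiffOn ℝ ∞ (comp1 a e i) (region e U)

/-- `g` is a smooth Lorentzian metric of signature `(+,-,-,-)` on the open set `U`. -/
structure IsLorentzMetricOn (g : TensorField2 M) (U : Set M) : Prop where
  smooth : Smooth2On g U
  symm : ∀ x ∈ U, ∀ v w, g x v w = g x w v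
  /-- existence of orthonormal frames -/
  signature : ∀ x ∈ U, ∃ b : Fin 4 → TangentSpace (𝓡 4) x,
    ∀ i j, g x (b i) (b j) = if i = j then (if i = 0 then 1 else -1) else 0

/-- `S` is a smooth embedded hypersurface of `M` (locally the zero set of a function with
nonvanishing differential) which is spacelike: all its nonzero tangent vectors have negative
square. -/
def IsSpacelikeHypersurface (g : TensorField2 M) (S : Set M) : Prop :=
  ∀ p ∈ S, ∃ (U : Set M) (f : M → ℝ), IsOpen U ∧ p ∈ U ∧ ContMDiffOn (𝓡 4) 𝓘(ℝ, ℝ) ∞ f U ∧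
    S ∩ U = {x ∈ U | f x = 0} ∧
    ∀ x ∈ S ∩ U, mfderiv (𝓡 4) 𝓘(ℝ, ℝ) f x ≠ 0 ∧
      ∀ v : TangentSpace (𝓡 4) x, v ≠ 0 → mfderiv (𝓡 4) 𝓘(ℝ, ℝ) f x v = 0 → g x v v < 0

/-! ## Matter -/

/-- `Tm` is the energy-momentum tensor of minimally coupled trace-free matter on `(U, g)`: a
smooth symmetric tensor field, trace-free and divergence-free. No sign is assumed, so that both
attractive and repulsive matter is included. -/
structure IsTraceFreeMatter (U : Set M) (g Tm : TensorField2 M) : Prop where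
  smooth : Smooth2On Tm U
  symm : ∀ x ∈ U, ∀ v w, Tm x v w = Tm x w v
  trace_eq : ∀ e ∈ Charts M, ∀ y ∈ region e U, trace (comp2 g e) (comp2 Tm e) y = 0
  div_eq : ∀ e ∈ Charts M, ∀ y ∈ region e U, ∀ j, divergence (comp2 g e) (comp2 Tm e) j y = 0

/-- `c α β γ` are the structure constants, `[e_β, e_γ] = ∑ α, c α β γ • e_α`, of a real Lie algebra
of dimension `N` in a basis that is orthonormal for an ad-invariant Euclidean inner product. -/
structure IsStructureConstants {N : ℕ} (c : Fin N → Fin N → Fin N → ℝ) : Prop where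
  antisymm₁ : ∀ α β γ, c α β γ = - c β α γ
  antisymm₂ : ∀ α β γ, c α β γ = - c α γ β
  jacobi : ∀ α β γ η, ∑ δ, (c α β δ * c δ γ η + c α γ δ * c δ η β + c α η δ * c δ β γ) = 0

/-- The Yang-Mills field strength
`F^α_{ij} = ∂_i A^α_j - ∂_j A^α_i + c^α_{βγ} A^β_i A^γ_j` of the gauge potential `A`. -/
def fieldStrength {N : ℕ} (c : Fin N → Fin N → Fin N → ℝ) (A : Fin N → Comp1)
    (α : Fin N) : Comp2 := fun i j y =>
  pd i (A α j) y - pd j (A α i) y + ∑ β, ∑ γ, c α β γ * A β i y * A γ j y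

/-- The Yang-Mills equations `g^{ki} (∇_k F^α_{ij} + c^α_{βγ} A^β_k F^γ_{ij}) = 0`. -/
def YangMillsEq {N : ℕ} (c : Fin N → Fin N → Fin N → ℝ) (g : Comp2) (A : Fin N → Comp1)
    (y : E4) : Prop :=
  ∀ α j, ∑ k, ∑ i, ginv g k i y * (covDeriv2 g (fieldStrength c A α) k i j y
    + ∑ β, ∑ γ, c α β γ * A β k y * fieldStrength c A γ i j y) = 0

/-- The trace-free Yang-Mills energy-momentum tensor
`F^α_{il} F^α_{mj} g^{lm} + g_{ij} F^α_{kl} F^α_{mn} g^{km} g^{ln} / 4`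
(with positive energy density in signature `(+,-,-,-)`). -/
def yangMillsEMT {N : ℕ} (g : Comp2) (F : Fin N → Comp2) (i j : Fin 4) (y : E4) : ℝ :=
  ∑ α, ((∑ l, ∑ m, ginv g l m y * F α i l y * F α m j y)
    + (1 / 4) * g i j y *
      ∑ k, ∑ l, ∑ m, ∑ n, ginv g k m y * ginv g l n y * F α k l y * F α m n y)

/-- `T` is the energy-momentum tensor on `(U, g)` of a Yang-Mills field (a Maxwell field if `N = 1`)
with structure constants `c`, given by gauge potentials in local gauges. -/
def IsYangMillsTensor {N : ℕ} (c : Fin N → Fin N → Fin N → ℝ) (U : Set M)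
    (g T : TensorField2 M) : Prop :=
  ∀ x ∈ U, ∃ (V : Set M) (A : Fin N → CovectorField M), IsOpen V ∧ x ∈ V ∧ V ⊆ U ∧
    (∀ α, Smooth1On (A α) V) ∧
    ∀ e ∈ Charts M, ∀ y ∈ region e V,
      YangMillsEq c (comp2 g e) (fun α => comp1 (A α) e) y ∧
      ∀ i j, comp2 T e i j y =
        yangMillsEMT (comp2 g e) (fieldStrength c fun α => comp1 (A α) e) i j y

/-- `T` is the energy-momentum tensor `T_{ij} = 4/3 ρ u_i u_j - 1/3 ρ g_{ij}` on `(U, g)` of a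
radiation fluid with density `ρ ≥ 0` and velocity `u`, `g^{ij} u_i u_j = 1`, that satisfies the
Euler equations `∇^i T_{ij} = 0`. -/
def IsRadiationFluidTensor (U : Set M) (g T : TensorField2 M) : Prop :=
  ∃ (ρ : M → ℝ) (u : CovectorField M), ContMDiffOn (𝓡 4) 𝓘(ℝ, ℝ) ∞ ρ U ∧ Smooth1On u U ∧
    (∀ x ∈ U, 0 ≤ ρ x) ∧
    (∀ x ∈ U, ∀ v w, T x v w = 4 / 3 * ρ x * u x v * u x w - 1 / 3 * ρ x * g x v w) ∧
    ∀ e ∈ Charts M, ∀ y ∈ region e U,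
      ∑ i, ∑ j, ginv (comp2 g e) i j y * comp1 u e i y * comp1 u e j y = 1 ∧
      ∀ j, divergence (comp2 g e) (comp2 T e) j y = 0

/-- `Tm` is the energy-momentum tensor of a Yang-Mills field together with a radiation fluid, each
of them either attractive (sign `1`) or repulsive (sign `-1`). -/
def IsYangMillsRadiationMatter {N : ℕ} (c : Fin N → Fin N → Fin N → ℝ) (U : Set M)
    (g Tm : TensorField2 M) : Prop :=
  IsStructureConstants c ∧ ∃ (s₁ s₂ : ℝ) (T₁ T₂ : TensorField2 M),
    (s₁ = 1 ∨ s₁ = -1) ∧ (s₂ = 1 ∨ s₂ = -1) ∧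
    IsYangMillsTensor c U g T₁ ∧ IsRadiationFluidTensor U g T₂ ∧
    ∀ x ∈ U, Tm x = s₁ • T₁ x + s₂ • T₂ x

/-- The components of the total energy-momentum tensor: conformal scalar field plus matter `Tm`. -/
def totalEMT (ε mu : ℝ) (g Tm : TensorField2 M) (φ : M → ℝ) (e : OpenPartialHomeomorph M E4) :
    Comp2 :=
  fun i j y => scalarEMT ε mu (comp2 g e) (comp0 φ e) i j y + comp2 Tm e i j y

/-- `(U, g)` with the conformal scalar field `φ` and further matter `Tm` solves the Einstein
equations `G_{ij} + 6 lam g_{ij} = T_{ij}` and the conformally invariant wave equation. -/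
structure IsConformalScalarSolution (U : Set M) (g : TensorField2 M) (φ : M → ℝ)
    (ε lam mu : ℝ) (Tm : TensorField2 M) : Prop where
  isOpen : IsOpen U
  metric : IsLorentzMetricOn g U
  smooth : ContMDiffOn (𝓡 4) 𝓘(ℝ, ℝ) ∞ φ U
  wave : ∀ e ∈ Charts M, ∀ y ∈ region e U, WaveEq mu (comp2 g e) (comp0 φ e) y
  einstein_eq : ∀ e ∈ Charts M, ∀ y ∈ region e U, ∀ i j,
    einstein (comp2 g e) i j y + 6 * lam * comp2 g e i j y = totalEMT ε mu g Tm φ e i j y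

/-! ## Conformal boundary, dual spacetime and isotropic singularities -/

/-- `(Mhat, ghat)` is weakly asymptotically flat through its conformal embedding, with conformal
factor `θ` (that is `g = θ² ghat`), as an open subset of the regular spacetime `(M, g)`; its
conformal boundary is the boundary of `Mhat` in `M`. -/
structure IsWeaklyAsymptoticallyFlat (g : TensorField2 M) (Mhat : Set M) (ghat : TensorField2 M)
    (θ : M → ℝ) : Prop where
  regular : IsLorentzMetricOn g univ
  isOpen : IsOpen Mhat
  metric : IsLorentzMetricOn ghat Mhat
  smooth : ContMDiff (𝓡 4) 𝓘(ℝ, ℝ) ∞ θ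
  conformal : ∀ x ∈ Mhat, g x = θ x ^ 2 • ghat x
  pos : ∀ x ∈ Mhat, 0 < θ x
  boundary_nonempty : (frontier Mhat).Nonempty
  boundary_zero : ∀ x ∈ frontier Mhat, θ x = 0
  boundary_deriv : ∀ x ∈ frontier Mhat, mfderiv (𝓡 4) 𝓘(ℝ, ℝ) θ x ≠ 0

/-- The dual spacetime lives on the part of `Mhat` where `φ` does not vanish. -/
def dualRegion (Mhat : Set M) (φ : M → ℝ) : Set M := {x ∈ Mhat | φ x ≠ 0}

/-- The dual metric `φ² ghat`. -/
def dualMetric (φ : M → ℝ) (ghat : TensorField2 M) : TensorField2 M :=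
  fun x => φ x ^ 2 • ghat x

/-- The size `∑ |t_{ij}|` of a tensor in the coordinate system `e`, at the point `x`. -/
def size (t : Comp2) (e : OpenPartialHomeomorph M E4) (x : M) : ℝ := ∑ i, ∑ j, |t i j (e x)|

/-- The Ricci tensor of `g'`, defined on `U`, is unbounded near `p`, in coordinates of `M` at `p`. -/
def RicciUnboundedNear (g' : TensorField2 M) (U : Set M) (p : M) : Prop :=
  ∀ e ∈ Charts M, p ∈ e.source →
    ∀ C : ℝ, ∃ᶠ x in 𝓝[U] p, C < size (ricci (comp2 g' e)) e x

/-- The Ricci tensor of `g'`, defined on `U`, is unbounded along each `C¹` curve in `U` that ends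
at `p`, in coordinates of `M` at `p`. -/
def RicciUnboundedAlongCurves (g' : TensorField2 M) (U : Set M) (p : M) : Prop :=
  ∀ e ∈ Charts M, p ∈ e.source →
    ∀ γ : ℝ → M, ContMDiffOn 𝓘(ℝ, ℝ) (𝓡 4) 1 γ (Icc 0 1) → (∀ s ∈ Ico (0 : ℝ) 1, γ s ∈ U) →
      γ 1 = p → ∀ C : ℝ, ∃ᶠ s in 𝓝[<] (1 : ℝ), C < size (ricci (comp2 g' e)) e (γ s)

/-- The Ricci tensor of `g'`, defined on `U`, tends to infinity at `p`, in coordinates of `M`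
at `p`. -/
def RicciDivergesAt (g' : TensorField2 M) (U : Set M) (p : M) : Prop :=
  ∀ e ∈ Charts M, p ∈ e.source → Tendsto (size (ricci (comp2 g' e)) e) (𝓝[U] p) atTop

/-- The hypersurface `S` of the spacetime `(M, g)` is an isotropic singularity of the spacetime
`(U, g')`, an open part of `M` with `g' = Ξ² g`: the metric `g` is regular, `Ξ` vanishes
on `S`, and the curvature of `g'` blows up as one approaches `S`. -/
def IsIsotropicSingularity (g : TensorField2 M) (U : Set M) (g' : TensorField2 M) (S : Set M) :
    Prop :=
  IsLorentzMetricOn g univ ∧ IsOpen U ∧ IsLorentzMetricOn g' U ∧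
  S.Nonempty ∧ IsSpacelikeHypersurface g S ∧ S ⊆ closure U ∧ Disjoint S U ∧
  (∃ Ξ : M → ℝ, ContMDiffOn (𝓡 4) 𝓘(ℝ, ℝ) ∞ Ξ U ∧ ContinuousOn Ξ (U ∪ S) ∧
    (∀ x ∈ U, Ξ x ≠ 0 ∧ g' x = Ξ x ^ 2 • g x) ∧ ∀ x ∈ S, Ξ x = 0) ∧
  ∀ p ∈ S, RicciUnboundedNear g' U p ∧ RicciUnboundedAlongCurves g' U p

end CCC

end

/-!
The argument rests on one identity: the energy-momentum tensor of a conformal scalar field `f` on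
`(U, g)` is, up to sign, `2 f² (L_{ij} - mu f² g_{ij})`, where `L` is the Schouten tensor of the
metric `f² g` (`scalarEMT_eq_schouten_rescale`, a form of the conformal change of the Schouten
tensor, `schouten_rescale`).

Applied to the physical field `φ`, and with the constant scalar curvature `24 mu` that the wave
equation gives to the dual metric, it says that the dual Ricci tensor is
`± φ⁻² T^{[φ]} + 6 mu φ² ghat` (`ricci_rescale_eq_scalarEMT`).  Applied to the dual field `φ⁻¹`, for
which the rescaled metric is `ghat` again, and combined with the Einstein equations, which for
trace-free matter read `2 (L_{ij} - lam g_{ij}) = T_{ij}`, it says that the energy-momentum tensor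
of the dual field is `± φ⁻² T` (`scalarEMT_dual`).  Since `φ⁻² = Φ⁻² θ⁻²`, both diverge where `Φ`
tends to zero and the rescaled tensor in question has a nonzero limit (`tendsto_size_atTop`).

If the scalar part of the rescaled tensor has no nonzero limit, the dual Ricci tensor need not tend
to infinity, but it is still unbounded.  The dual metric is `Φ² g` with regular `g`.  Put
`u = Φ⁻¹`, `w = |du|² / (2 u)` and let `Q` be the difference of the Schouten tensors of `g` and
`Φ² g`.  Then `∇_i ∇_j u = - Q_{ij} u + w g_{ij}` and `∇_i w = - Q_{ij} ∇^j u`: along a curve,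
`(u, du, w)` solves a linear system, whose coefficients are bounded if the dual Ricci tensor is.  By
Grönwall's inequality `u` is then bounded, so that `Φ` cannot tend to zero
(`inv_bounded_along_curve`).  This gives unboundedness along each curve to the boundary; for
unboundedness near a boundary point, a coordinate segment towards the point is followed until it
leaves the dual spacetime, which happens at a zero of `Φ`
(`ricciUnboundedNear_of_scalarCurv`).
-/

noncomputable section

namespace CCC

/-! ### Partial derivatives -/

section PartialDerivatives

variable {U : Set E4} {y : E4} {f h : E4 → ℝ}

lemma pd_congr (i : Fin 4) (H : f =ᶠ[𝓝 y] h) : pd i f y = pd i h y := by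
  unfold pd; rw [H.fderiv_eq]

lemma pd_const (i : Fin 4) (a : ℝ) : pd i (fun _ => a) y = 0 := by
  simp [pd]

lemma pd_add (i : Fin 4) (hf : DifferentiableAt ℝ f y) (hh : DifferentiableAt ℝ h y) :
    pd i (fun z => f z + h z) y = pd i f y + pd i h y := by
  unfold pd; rw [fderiv_fun_add hf hh]; rfl

lemma pd_sub (i : Fin 4) (hf : DifferentiableAt ℝ f y) (hh : DifferentiableAt ℝ h y) :
    pd i (fun z => f z - h z) y = pd i f y - pd i h y := by
  unfold pd; rw [fderiv_fun_sub hf hh]; rfl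

lemma pd_mul (i : Fin 4) (hf : DifferentiableAt ℝ f y) (hh : DifferentiableAt ℝ h y) :
    pd i (fun z => f z * h z) y = pd i f y * h y + f y * pd i h y := by
  unfold pd; rw [fderiv_fun_mul hf hh]; simp; ring

lemma pd_const_mul (i : Fin 4) (a : ℝ) (hf : DifferentiableAt ℝ f y) :
    pd i (fun z => a * f z) y = a * pd i f y := by
  unfold pd; rw [fderiv_const_mul hf]; rfl

lemma pd_sum (i : Fin 4) {ι : Type*} (s : Finset ι) {F : ι → E4 → ℝ}
    (hF : ∀ a ∈ s, DifferentiableAt ℝ (F a) y) :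
    pd i (fun z => ∑ a ∈ s, F a z) y = ∑ a ∈ s, pd i (F a) y := by
  unfold pd; rw [fderiv_fun_sum hF]; simp

lemma pd_inv (i : Fin 4) (hf : DifferentiableAt ℝ f y) (h0 : f y ≠ 0) :
    pd i (fun z => (f z)⁻¹) y = - pd i f y / f y ^ 2 := by
  unfold pd
  have h := (hasDerivAt_inv h0).comp_hasFDerivAt y hf.hasFDerivAt
  have h' : fderiv ℝ (fun z => (f z)⁻¹) y = _ := h.fderiv
  rw [h']
  simp; ring

lemma pd_sq (i : Fin 4) (hf : DifferentiableAt ℝ f y) :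
    pd i (fun z => f z ^ 2) y = 2 * f y * pd i f y := by
  have : (fun z => f z ^ 2) = fun z => f z * f z := by funext z; ring
  rw [this, pd_mul i hf hf]; ring

lemma contDiffOn_pd (hU : IsOpen U) (hf : ContDiffOn ℝ ∞ f U) (i : Fin 4) :
    ContDiffOn ℝ ∞ (pd i f) U :=
  (hf.fderiv_of_isOpen hU (by simp)).clm_apply contDiffOn_const

lemma differentiableAt_of_contDiffOn (hU : IsOpen U) (hf : ContDiffOn ℝ ∞ f U) (hy : y ∈ U) :
    DifferentiableAt ℝ f y :=
  (hf.contDiffAt (hU.mem_nhds hy)).differentiableAt (by simp)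

lemma pd_comm (hU : IsOpen U) (hf : ContDiffOn ℝ ∞ f U) (hy : y ∈ U) (i j : Fin 4) :
    pd i (pd j f) y = pd j (pd i f) y := by
  have hd : DifferentiableAt ℝ (fderiv ℝ f) y :=
    ((hf.fderiv_of_isOpen hU (m := ∞) (by simp)).contDiffAt (hU.mem_nhds hy)).differentiableAt
      (by simp)
  have key : ∀ a b, pd a (pd b f) y = fderiv ℝ (fderiv ℝ f) y (basisVec a) (basisVec b) := by
    intro a b
    unfold pd
    rw [fderiv_clm_apply hd (differentiableAt_const _)]
    simp
  rw [key, key]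
  have hs : IsSymmSndFDerivAt ℝ f y :=
    (hf.contDiffAt (hU.mem_nhds hy)).isSymmSndFDerivAt
      (by simpa using WithTop.coe_le_coe.2 (le_top : (2 : ℕ∞) ≤ ⊤))
  exact hs _ _

/-- The chain rule along a curve, in terms of partial derivatives. -/
lemma hasDerivAt_comp_curve {x : ℝ → E4} {v : E4} {s : ℝ} (hx : HasDerivAt x v s)
    (hf : DifferentiableAt ℝ f (x s)) :
    HasDerivAt (fun t => f (x t)) (∑ k, v k * pd k f (x s)) s := by
  have h1 := hf.hasFDerivAt.comp_hasDerivAt s hx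
  have h2 : fderiv ℝ f (x s) v = ∑ k, v k * pd k f (x s) := by
    have hv : v = ∑ k, v k • basisVec k := by
      have := (EuclideanSpace.basisFun (Fin 4) ℝ).sum_repr v
      simpa [basisVec] using this.symm
    conv_lhs => rw [hv]
    simp [pd]
  rw [← h2]; exact h1

end PartialDerivatives

/-! ### The metric, its inverse and the Christoffel symbols -/

/-- `g` is the component matrix of a smooth nondegenerate symmetric tensor on the open set `U`. -/
structure IsMetricOn (g : Comp2) (U : Set E4) : Prop where
  isOpen : IsOpen U
  smooth : ∀ i j, ContDiffOn ℝ ∞ (g i j) U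
  symm : ∀ y ∈ U, ∀ i j, g i j y = g j i y
  det_ne_zero : ∀ y ∈ U, (Matrix.of fun a b => g a b y).det ≠ 0

section Metric

variable {U : Set E4} {g : Comp2} {y : E4}

lemma sum_ginv_mul (hg : IsMetricOn g U) (hy : y ∈ U) (i j : Fin 4) :
    ∑ k, ginv g i k y * g k j y = if i = j then 1 else 0 := by
  have h := Matrix.nonsing_inv_mul _ (isUnit_iff_ne_zero.2 (hg.det_ne_zero y hy))
  have h2 := congrFun (congrFun h i) j
  simpa [Matrix.mul_apply, Matrix.one_apply, ginv] using h2

lemma sum_mul_ginv (hg : IsMetricOn g U) (hy : y ∈ U) (i j : Fin 4) :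
    ∑ k, g i k y * ginv g k j y = if i = j then 1 else 0 := by
  have h := Matrix.mul_nonsing_inv _ (isUnit_iff_ne_zero.2 (hg.det_ne_zero y hy))
  have h2 := congrFun (congrFun h i) j
  simpa [Matrix.mul_apply, Matrix.one_apply, ginv] using h2

lemma contDiffOn_det {n : ℕ} {U : Set E4} {A : Fin n → Fin n → E4 → ℝ}
    (hA : ∀ i j, ContDiffOn ℝ ∞ (A i j) U) :
    ContDiffOn ℝ ∞ (fun y => (Matrix.of fun a b => A a b y).det) U := by
  simp only [Matrix.det_apply', Matrix.of_apply]
  exact ContDiffOn.sum fun σ _ => contDiffOn_const.mul (contDiffOn_prod fun i _ => hA _ _)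

lemma contDiffOn_ginv (hg : IsMetricOn g U) (i j : Fin 4) : ContDiffOn ℝ ∞ (ginv g i j) U := by
  have h : ginv g i j = fun y => ((Matrix.of fun a b => g a b y).det)⁻¹ *
      (Matrix.of fun a b =>
        (fun z => if a = j then (Pi.single i (1 : ℝ) : Fin 4 → ℝ) b else g a b z) y).det := by
    funext y
    unfold ginv
    rw [Matrix.inv_def, Ring.inverse_eq_inv', Matrix.smul_apply, smul_eq_mul, Matrix.adjugate_apply]
    congr 2
    ext a b
    simp [Matrix.updateRow_apply]
  rw [h]
  refine ((contDiffOn_det hg.smooth).inv hg.det_ne_zero).mul (contDiffOn_det fun a b => ?_)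
  by_cases hab : a = j
  · simp only [hab, if_true]; exact contDiffOn_const
  · simp only [hab, if_false]; exact hg.smooth a b

lemma contDiffOn_christoffel (hg : IsMetricOn g U) (k i j : Fin 4) :
    ContDiffOn ℝ ∞ (christoffel g k i j) U := by
  refine contDiffOn_const.mul (ContDiffOn.sum fun l _ => (contDiffOn_ginv hg k l).mul ?_)
  exact ((contDiffOn_pd hg.isOpen (hg.smooth _ _) _).add
    (contDiffOn_pd hg.isOpen (hg.smooth _ _) _)).sub (contDiffOn_pd hg.isOpen (hg.smooth _ _) _)

lemma contDiffOn_ricci (hg : IsMetricOn g U) (i j : Fin 4) : ContDiffOn ℝ ∞ (ricci g i j) U := by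
  have h := contDiffOn_christoffel hg
  refine ContDiffOn.sum fun k _ => ContDiffOn.add (ContDiffOn.sub ?_ ?_)
    (ContDiffOn.sum fun m _ => ((h _ _ _).mul (h _ _ _)).sub ((h _ _ _).mul (h _ _ _)))
  · exact contDiffOn_pd hg.isOpen (h _ _ _) _
  · exact contDiffOn_pd hg.isOpen (h _ _ _) _

lemma contDiffOn_schouten (hg : IsMetricOn g U) (i j : Fin 4) :
    ContDiffOn ℝ ∞ (schouten g i j) U := by
  have h : ContDiffOn ℝ ∞ (scalarCurv g) U :=
    ContDiffOn.sum (s := Finset.univ) fun i _ => ContDiffOn.sum (s := Finset.univ) fun j _ =>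
      (contDiffOn_ginv hg i j).mul (contDiffOn_ricci hg i j)
  exact contDiffOn_const.mul
    ((contDiffOn_ricci hg i j).sub ((contDiffOn_const.mul h).mul (hg.smooth i j)))

lemma pd_symm (hg : IsMetricOn g U) (hy : y ∈ U) (k i j : Fin 4) :
    pd k (g i j) y = pd k (g j i) y :=
  pd_congr k ((hg.isOpen.eventually_mem hy).mono fun z hz => hg.symm z hz i j)

lemma christoffel_symm (hg : IsMetricOn g U) (hy : y ∈ U) (k i j : Fin 4) :
    christoffel g k i j y = christoffel g k j i y := by
  unfold christoffel
  congr 1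
  refine Finset.sum_congr rfl fun l _ => ?_
  rw [pd_symm hg hy l i j]; ring

lemma sum_mul_christoffel (hg : IsMetricOn g U) (hy : y ∈ U) (a i j : Fin 4) :
    ∑ m, g a m y * christoffel g m i j y =
      (1 / 2) * (pd i (g a j) y + pd j (g a i) y - pd a (g i j) y) := by
  have h : ∀ m, g a m y * christoffel g m i j y = ∑ l, (1 / 2) * ((g a m y * ginv g m l y) *
      (pd i (g l j) y + pd j (g l i) y - pd l (g i j) y)) := by
    intro m
    unfold christoffel
    rw [Finset.mul_sum, Finset.mul_sum]
    exact Finset.sum_congr rfl fun l _ => by ring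
  simp_rw [h]
  rw [Finset.sum_comm]
  simp_rw [← Finset.mul_sum, ← Finset.sum_mul, sum_mul_ginv hg hy]
  simp

/-- The metric is covariantly constant. -/
lemma pd_metric (hg : IsMetricOn g U) (hy : y ∈ U) (k i j : Fin 4) :
    pd k (g i j) y =
      ∑ m, (christoffel g m k i y * g m j y + christoffel g m k j y * g i m y) := by
  have h1 := sum_mul_christoffel hg hy j k i
  have h2 := sum_mul_christoffel hg hy i k j
  have h3 : ∀ m, christoffel g m k i y * g m j y = g j m y * christoffel g m k i y := by
    intro m; rw [hg.symm y hy m j]; ring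
  have h4 : ∀ m, christoffel g m k j y * g i m y = g i m y * christoffel g m k j y := by
    intro m; ring
  rw [Finset.sum_add_distrib, Finset.sum_congr rfl fun m _ => h3 m,
    Finset.sum_congr rfl fun m _ => h4 m, h1, h2, pd_symm hg hy k j i, pd_symm hg hy i j k,
    pd_symm hg hy j k i]
  ring

lemma trace_self (hg : IsMetricOn g U) (hy : y ∈ U) : trace g g y = 4 := by
  have h : ∀ i, ∑ j, ginv g i j y * g i j y = 1 := by
    intro i
    have := sum_ginv_mul hg hy i i
    rw [if_pos rfl] at this
    rw [← this]
    exact Finset.sum_congr rfl fun j _ => by rw [hg.symm y hy i j]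
  simp [trace, h]

/-! #### Locality -/

variable {h : Comp2}

lemma ginv_congr (H : ∀ i j, g i j y = h i j y) (i j : Fin 4) : ginv g i j y = ginv h i j y := by
  unfold ginv
  have : (Matrix.of fun a b => g a b y) = Matrix.of fun a b => h a b y := by
    ext a b; exact H a b
  rw [this]

lemma christoffel_congr (H : ∀ i j, g i j =ᶠ[𝓝 y] h i j) (k i j : Fin 4) :
    christoffel g k i j y = christoffel h k i j y := by
  unfold christoffel
  congr 1
  refine Finset.sum_congr rfl fun l _ => ?_
  rw [ginv_congr (fun i j => (H i j).eq_of_nhds), pd_congr i (H l j), pd_congr j (H l i),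
    pd_congr l (H i j)]

lemma ricci_congr (H : ∀ i j, g i j =ᶠ[𝓝 y] h i j) (i j : Fin 4) :
    ricci g i j y = ricci h i j y := by
  have hc : ∀ k a b, christoffel g k a b =ᶠ[𝓝 y] christoffel h k a b := by
    intro k a b
    have : ∀ᶠ z in 𝓝 y, ∀ i j, g i j =ᶠ[𝓝 z] h i j := by
      simp only [eventually_all]
      exact fun i j => (H i j).eventuallyEq_nhds
    exact this.mono fun z hz => christoffel_congr hz k a b
  unfold ricci
  refine Finset.sum_congr rfl fun k _ => ?_
  rw [pd_congr k (hc k i j), pd_congr i (hc k k j)]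
  congr 1
  refine Finset.sum_congr rfl fun m _ => ?_
  rw [(hc k k m).eq_of_nhds, (hc m i j).eq_of_nhds, (hc k i m).eq_of_nhds, (hc m k j).eq_of_nhds]

lemma trace_congr (H : ∀ i j, g i j y = h i j y) {s t : Comp2} (K : ∀ i j, s i j y = t i j y) :
    trace g s y = trace h t y := by
  unfold trace
  exact Finset.sum_congr rfl fun i _ => Finset.sum_congr rfl fun j _ => by
    rw [ginv_congr H, K]

lemma schouten_congr (H : ∀ i j, g i j =ᶠ[𝓝 y] h i j) (i j : Fin 4) :
    schouten g i j y = schouten h i j y := by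
  unfold schouten scalarCurv
  rw [trace_congr (fun i j => (H i j).eq_of_nhds) (ricci_congr H), ricci_congr H,
    (H i j).eq_of_nhds]

/-! #### Traces -/

lemma trace_add (s t : Comp2) :
    trace g (fun i j z => s i j z + t i j z) y = trace g s y + trace g t y := by
  simp [trace, mul_add, Finset.sum_add_distrib]

lemma trace_mul (a : E4 → ℝ) (t : Comp2) :
    trace g (fun i j z => a z * t i j z) y = a y * trace g t y := by
  simp only [trace, Finset.mul_sum]
  exact Finset.sum_congr rfl fun i _ => Finset.sum_congr rfl fun j _ => by ring

end Metric

/-! ### Raising an index -/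

section Raise

variable {U : Set E4} {g : Comp2} {Y : Comp1} {y : E4}

/-- The vector field `Y^k = g^{kl} Y_l`. -/
def raise (g : Comp2) (Y : Comp1) (k : Fin 4) (y : E4) : ℝ := ∑ l, ginv g k l y * Y l y

/-- The covariant derivative `∇_i Y_j` of a covector field. -/
def covDeriv1 (g : Comp2) (Y : Comp1) (i j : Fin 4) (y : E4) : ℝ :=
  pd i (Y j) y - ∑ m, christoffel g m i j y * Y m y

/-- The squared norm `g^{ij} Y_i Y_j`. -/
def normSq (g : Comp2) (Y : Comp1) (y : E4) : ℝ := ∑ m, raise g Y m y * Y m y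

lemma gradSq_eq_normSq (f : E4 → ℝ) : gradSq g f y = normSq g (fun i => pd i f) y := by
  unfold gradSq normSq raise
  rw [Finset.sum_comm]
  refine (Finset.sum_comm).trans (Finset.sum_congr rfl fun i _ => ?_)
  rw [Finset.sum_mul]
  exact Finset.sum_congr rfl fun j _ => by ring

lemma contDiffOn_raise (hg : IsMetricOn g U) (hY : ∀ i, ContDiffOn ℝ ∞ (Y i) U) (k : Fin 4) :
    ContDiffOn ℝ ∞ (raise g Y k) U :=
  ContDiffOn.sum (s := Finset.univ) fun l _ => (contDiffOn_ginv hg k l).mul (hY l)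

lemma sum_mul_raise (hg : IsMetricOn g U) (hy : y ∈ U) (j : Fin 4) :
    ∑ m, g j m y * raise g Y m y = Y j y := by
  unfold raise
  simp_rw [Finset.mul_sum, ← mul_assoc]
  rw [Finset.sum_comm]
  simp_rw [← Finset.sum_mul, sum_mul_ginv hg hy]
  simp

/-- Lowering the index commutes with covariant differentiation. -/
lemma sum_mul_covDeriv_raise (hg : IsMetricOn g U) (hY : ∀ i, ContDiffOn ℝ ∞ (Y i) U)
    (hy : y ∈ U) (i j : Fin 4) :
    ∑ m, g j m y * (pd i (raise g Y m) y + ∑ n, christoffel g m i n y * raise g Y n y) =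
      covDeriv1 g Y i j y := by
  have hd : ∀ m, DifferentiableAt ℝ (raise g Y m) y := fun m =>
    differentiableAt_of_contDiffOn hg.isOpen (contDiffOn_raise hg hY m) hy
  have hdg : ∀ a b, DifferentiableAt ℝ (g a b) y := fun a b =>
    differentiableAt_of_contDiffOn hg.isOpen (hg.smooth a b) hy
  have h1 : pd i (Y j) y = ∑ m, (pd i (g j m) y * raise g Y m y
      + g j m y * pd i (raise g Y m) y) := by
    have : Y j =ᶠ[𝓝 y] fun z => ∑ m, g j m z * raise g Y m z :=
      (hg.isOpen.eventually_mem hy).mono fun z hz => (sum_mul_raise hg hz j).symm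
    rw [pd_congr i this, pd_sum i _ fun m _ => (hdg j m).fun_mul (hd m)]
    exact Finset.sum_congr rfl fun m _ => pd_mul i (hdg j m) (hd m)
  have h2 : ∑ m, pd i (g j m) y * raise g Y m y =
      ∑ m, christoffel g m i j y * Y m y
        + ∑ m, g j m y * ∑ n, christoffel g m i n y * raise g Y n y := by
    simp_rw [pd_metric hg hy, Finset.sum_add_distrib, add_mul, Finset.sum_add_distrib,
      ← sum_mul_raise (Y := Y) hg hy, Finset.sum_mul, Finset.mul_sum]
    congr 1
    · rw [Finset.sum_comm]
      exact Finset.sum_congr rfl fun m _ => Finset.sum_congr rfl fun n _ => by ring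
    · rw [Finset.sum_comm]
      exact Finset.sum_congr rfl fun m _ => Finset.sum_congr rfl fun n _ => by ring
  unfold covDeriv1
  rw [h1, Finset.sum_add_distrib, h2]
  simp_rw [mul_add, Finset.sum_add_distrib]
  ring

/-- The divergence of `Y^k` is the trace of `∇_i Y_j`. -/
lemma sum_covDeriv_raise (hg : IsMetricOn g U) (hY : ∀ i, ContDiffOn ℝ ∞ (Y i) U) (hy : y ∈ U) :
    ∑ k, (pd k (raise g Y k) y + ∑ m, christoffel g k k m y * raise g Y m y) =
      trace g (covDeriv1 g Y) y := by
  unfold trace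
  simp_rw [← sum_mul_covDeriv_raise hg hY hy, Finset.mul_sum, ← mul_assoc]
  refine Finset.sum_congr rfl fun i _ => ?_
  rw [Finset.sum_comm]
  simp_rw [← Finset.sum_mul, sum_ginv_mul hg hy]
  simp

/-- The product rule `∂_i |Y|² = 2 Y^j ∇_i Y_j`. -/
lemma pd_normSq (hg : IsMetricOn g U) (hY : ∀ i, ContDiffOn ℝ ∞ (Y i) U) (hy : y ∈ U)
    (i : Fin 4) :
    pd i (normSq g Y) y = 2 * ∑ j, raise g Y j y * covDeriv1 g Y i j y := by
  have hd : ∀ m, DifferentiableAt ℝ (raise g Y m) y := fun m =>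
    differentiableAt_of_contDiffOn hg.isOpen (contDiffOn_raise hg hY m) hy
  have hdY : ∀ m, DifferentiableAt ℝ (Y m) y := fun m =>
    differentiableAt_of_contDiffOn hg.isOpen (hY m) hy
  have h1 : pd i (normSq g Y) y =
      ∑ m, pd i (raise g Y m) y * Y m y + ∑ m, raise g Y m y * pd i (Y m) y := by
    rw [← Finset.sum_add_distrib]
    unfold normSq
    rw [pd_sum i _ fun m _ => (hd m).fun_mul (hdY m)]
    exact Finset.sum_congr rfl fun m _ => pd_mul i (hd m) (hdY m)
  have h2 : ∑ j, raise g Y j y * covDeriv1 g Y i j y =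
      ∑ m, raise g Y m y * pd i (Y m) y
        - ∑ n, ∑ m, raise g Y m y * (christoffel g n i m y * Y n y) := by
    unfold covDeriv1
    simp_rw [mul_sub, Finset.sum_sub_distrib, Finset.mul_sum]
    rw [Finset.sum_comm (f := fun a b => raise g Y a y * (christoffel g b i a y * Y b y))]
  have h3 : ∑ j, raise g Y j y * covDeriv1 g Y i j y =
      ∑ m, pd i (raise g Y m) y * Y m y
        + ∑ n, ∑ m, raise g Y m y * (christoffel g n i m y * Y n y) := by
    simp_rw [← sum_mul_covDeriv_raise hg hY hy, Finset.mul_sum]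
    rw [Finset.sum_comm, ← Finset.sum_add_distrib]
    refine Finset.sum_congr rfl fun m _ => ?_
    have h4 : ∀ j, raise g Y j y * (g j m y *
        (pd i (raise g Y m) y + ∑ n, christoffel g m i n y * raise g Y n y)) =
        g m j y * raise g Y j y *
        (pd i (raise g Y m) y + ∑ n, christoffel g m i n y * raise g Y n y) := by
      intro j; rw [hg.symm y hy j m]; ring
    simp_rw [h4]
    rw [← Finset.sum_mul, sum_mul_raise hg hy, mul_add, Finset.mul_sum]
    congr 1
    · ring
    · exact Finset.sum_congr rfl fun n _ => by ring
  rw [h1]; linarith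

end Raise

/-! ### Conformal change of the curvature -/

section ConformalAlgebra

variable {Γ C : Fin 4 → Fin 4 → Fin 4 → ℝ} {dC : Fin 4 → Fin 4 → Fin 4 → Fin 4 → ℝ}
  {G dY dV : Fin 4 → Fin 4 → ℝ} {dG : Fin 4 → Fin 4 → Fin 4 → ℝ} {Y V : Fin 4 → ℝ}

/-- The algebra behind the conformal change of the Ricci tensor, at one point: `Γ` are the
Christoffel symbols, `C` is their change, `G` the metric, `Y` and `V` the logarithmic derivative
of the conformal factor with its index down and up; `dC`, `dG`, `dY`, `dV` are their partial
derivatives, the first index being that of the differentiation. -/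
lemma ricci_change_algebra
    (hC : ∀ k i j, C k i j = (if k = i then Y j else 0) + (if k = j then Y i else 0) - G i j * V k)
    (hdC : ∀ a k i j, dC a k i j = (if k = i then dY a j else 0) + (if k = j then dY a i else 0)
      - (dG a i j * V k + G i j * dV a k))
    (hdG : ∀ k i j, dG k i j = ∑ m, (Γ m k i * G m j + Γ m k j * G i m))
    (hdV : ∀ i j, ∑ m, (dG i j m * V m + G j m * dV i m) = dY i j)
    (hGV : ∀ j, ∑ m, G j m * V m = Y j) (hG : ∀ i j, G i j = G j i)
    (hΓ : ∀ k i j, Γ k i j = Γ k j i) (hdY : ∀ i j, dY i j = dY j i) (j l : Fin 4) :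
    ∑ k, (dC k k j l - dC j k k l
      + ∑ m, ((Γ k k m + C k k m) * (Γ m j l + C m j l)
        - (Γ k j m + C k j m) * (Γ m k l + C m k l)))
    = ∑ k, ∑ m, (Γ k k m * Γ m j l - Γ k j m * Γ m k l)
      - 2 * (dY j l - ∑ m, Γ m j l * Y m - Y j * Y l)
      - (∑ k, (dV k k + ∑ m, Γ k k m * V m) + 2 * ∑ m, V m * Y m) * G j l := by
  have hCtr : ∀ m, ∑ k, C k k m = 4 * Y m := by
    intro m
    have : ∀ k, G k m * V k = G m k * V k := fun k => by rw [hG k m]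
    simp only [hC, Finset.sum_add_distrib, Finset.sum_sub_distrib, this, hGV]
    simp
  have hdCtr : ∑ k, dC j k k l = 4 * dY j l := by
    have : ∀ k, dG j k l * V k + G k l * dV j k = dG j l k * V k + G l k * dV j k := by
      intro k
      have : dG j k l = dG j l k := by
        rw [hdG, hdG]
        refine Finset.sum_congr rfl fun m _ => ?_
        rw [hG m l, hG m k]; ring
      rw [hG k l, this]
    have e : ∀ k, dC j k k l = dY j l + (if k = l then dY j k else 0)
        - (dG j l k * V k + G l k * dV j k) := by
      intro k; rw [hdC, this, if_pos rfl]
    rw [Finset.sum_congr rfl fun k _ => e k, Finset.sum_sub_distrib, hdV]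
    simp [Finset.sum_add_distrib]
  have hdC1 : ∑ k, dC k k j l =
      2 * dY j l - ∑ k, dG k j l * V k - (∑ k, dV k k) * G j l := by
    simp only [hdC, Finset.sum_add_distrib, Finset.sum_sub_distrib]
    simp only [Finset.sum_ite_eq', Finset.mem_univ, if_true, ← Finset.mul_sum]
    rw [hdY l j]; ring
  have hdGV : ∑ k, dG k j l * V k =
      ∑ k, ∑ m, Γ m j k * V k * G m l + ∑ k, ∑ m, Γ m k l * V k * G j m := by
    rw [← Finset.sum_add_distrib]
    refine Finset.sum_congr rfl fun k _ => ?_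
    rw [hdG, Finset.sum_mul, ← Finset.sum_add_distrib]
    refine Finset.sum_congr rfl fun m _ => ?_
    rw [hΓ m k j]; ring
  have h1 : ∑ k, ∑ m, Γ k k m * C m j l = (∑ k, Γ k k j) * Y l + (∑ k, Γ k k l) * Y j
      - (∑ k, ∑ m, Γ k k m * V m) * G j l := by
    simp only [hC, mul_add, mul_sub, Finset.sum_add_distrib, Finset.sum_sub_distrib, mul_ite,
      mul_zero, Finset.sum_ite_eq', Finset.mem_univ, if_true, Finset.sum_mul]
    congr 1
    exact Finset.sum_congr rfl fun k _ => Finset.sum_congr rfl fun m _ => by ring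
  have h2 : ∑ k, ∑ m, C k k m * Γ m j l = 4 * ∑ m, Γ m j l * Y m := by
    rw [Finset.sum_comm]
    simp_rw [← Finset.sum_mul, hCtr, Finset.mul_sum]
    exact Finset.sum_congr rfl fun m _ => by ring
  have h3 : ∑ k, ∑ m, Γ k j m * C m k l = (∑ k, Γ k k j) * Y l + ∑ m, Γ m j l * Y m
      - ∑ k, ∑ m, Γ m j k * V k * G m l := by
    simp only [hC, mul_add, mul_sub, Finset.sum_add_distrib, Finset.sum_sub_distrib, mul_ite,
      mul_zero, Finset.sum_ite_eq', Finset.mem_univ, if_true, Finset.sum_mul]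
    congr 1
    · congr 1
      exact Finset.sum_congr rfl fun k _ => by rw [hΓ]
    · rw [Finset.sum_comm]
      exact Finset.sum_congr rfl fun k _ => Finset.sum_congr rfl fun m _ => by ring
  have h4 : ∑ k, ∑ m, C k j m * Γ m k l = ∑ m, Γ m j l * Y m + (∑ k, Γ k k l) * Y j
      - ∑ k, ∑ m, Γ m k l * V k * G j m := by
    simp only [hC, add_mul, sub_mul, Finset.sum_add_distrib, Finset.sum_sub_distrib, ite_mul,
      zero_mul, Finset.sum_ite_eq, Finset.mem_univ, if_true, Finset.sum_mul]
    congr 1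
    · congr 1
      · rw [Finset.sum_comm]
        simp only [Finset.sum_ite_eq', Finset.mem_univ, if_true]
        exact Finset.sum_congr rfl fun k _ => by ring
      · exact Finset.sum_congr rfl fun k _ => by ring
    · exact Finset.sum_congr rfl fun k _ => Finset.sum_congr rfl fun m _ => by ring
  have hYC : ∑ m, Y m * C m j l = 2 * Y j * Y l - (∑ m, V m * Y m) * G j l := by
    simp only [hC, mul_add, mul_sub, Finset.sum_add_distrib, Finset.sum_sub_distrib, mul_ite,
      mul_zero, Finset.sum_ite_eq', Finset.mem_univ, if_true, Finset.sum_mul]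
    congr 1
    · ring
    · exact Finset.sum_congr rfl fun m _ => by ring
  have h5 : ∑ k, ∑ m, C k k m * C m j l = 8 * Y j * Y l - 4 * (∑ m, V m * Y m) * G j l := by
    rw [Finset.sum_comm]
    simp_rw [← Finset.sum_mul, hCtr, mul_assoc, ← Finset.mul_sum, hYC]
    ring
  have h6 : ∑ k, ∑ m, C k j m * C m k l = 6 * Y j * Y l - 2 * (∑ m, V m * Y m) * G j l := by
    have e1 : ∀ k, ∑ m, C k j m * C m k l = (if k = j then ∑ m, Y m * C m k l else 0)
        + Y j * C k k l - V k * ∑ m, G j m * C m k l := by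
      intro k
      have e : ∀ m, C k j m * C m k l = (if k = j then Y m * C m k l else 0)
          + (if k = m then Y j * C m k l else 0) - V k * (G j m * C m k l) := by
        intro m
        rw [hC k j m]
        split_ifs <;> ring
      simp only [e, Finset.sum_add_distrib, Finset.sum_sub_distrib, Finset.sum_ite_eq,
        Finset.mem_univ, if_true, ← Finset.mul_sum]
      congr 2
      split_ifs <;> simp
    have e2 : ∀ k, ∑ m, G j m * C m k l = G j k * Y l + G j l * Y k - G k l * Y j := by
      intro k
      have e : ∀ m, G j m * C m k l = (if m = k then G j m * Y l else 0)
          + (if m = l then G j m * Y k else 0) - G k l * (G j m * V m) := by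
        intro m
        rw [hC m k l]
        split_ifs <;> ring
      simp only [e, Finset.sum_add_distrib, Finset.sum_sub_distrib, Finset.sum_ite_eq',
        Finset.mem_univ, if_true, ← Finset.mul_sum, hGV]
    have e3 : ∑ k, V k * (G j k * Y l + G j l * Y k - G k l * Y j) =
        (∑ m, V m * Y m) * G j l := by
      have e : ∀ k, V k * (G j k * Y l + G j l * Y k - G k l * Y j) =
          Y l * (G j k * V k) + G j l * (V k * Y k) - Y j * (G l k * V k) := by
        intro k; rw [hG k l]; ring
      simp only [e, Finset.sum_add_distrib, Finset.sum_sub_distrib, ← Finset.mul_sum, hGV]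
      ring
    simp only [e1, e2, Finset.sum_add_distrib, Finset.sum_sub_distrib, e3, ← Finset.mul_sum, hCtr,
      Finset.sum_ite_eq', Finset.mem_univ, if_true, hYC]
    ring
  have hexp : ∀ k m, (Γ k k m + C k k m) * (Γ m j l + C m j l)
        - (Γ k j m + C k j m) * (Γ m k l + C m k l) =
      (Γ k k m * Γ m j l - Γ k j m * Γ m k l) + Γ k k m * C m j l + C k k m * Γ m j l
        + C k k m * C m j l - Γ k j m * C m k l - C k j m * Γ m k l - C k j m * C m k l := by
    intro k m; ring
  simp_rw [hexp]
  simp only [Finset.sum_add_distrib, Finset.sum_sub_distrib]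
  rw [hdC1, hdCtr, h1, h2, h3, h4, h5, h6, hdGV]
  ring

end ConformalAlgebra

section ConformalChange

variable {U : Set E4} {g : Comp2} {f : E4 → ℝ} {y : E4}

/-- The components of the conformally rescaled metric `f² g`. -/
def rescale (f : E4 → ℝ) (g : Comp2) : Comp2 := fun i j y => f y ^ 2 * g i j y

/-- The logarithmic derivative `∂ᵢ f / f`. -/
def logDer (f : E4 → ℝ) : Comp1 := fun i y => pd i f y / f y

lemma IsMetricOn.rescale (hg : IsMetricOn g U) (hf : ContDiffOn ℝ ∞ f U) (h0 : ∀ y ∈ U, f y ≠ 0) :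
    IsMetricOn (rescale f g) U where
  isOpen := hg.isOpen
  smooth i j := (hf.pow 2).mul (hg.smooth i j)
  symm y hy i j := by simp only [CCC.rescale, hg.symm y hy i j]
  det_ne_zero y hy := by
    have : (Matrix.of fun a b => CCC.rescale f g a b y) =
        f y ^ 2 • Matrix.of fun a b => g a b y := by
      ext a b; simp [CCC.rescale]
    rw [this, Matrix.det_smul]
    exact mul_ne_zero (pow_ne_zero _ (pow_ne_zero _ (h0 y hy))) (hg.det_ne_zero y hy)

lemma IsMetricOn.mono {V : Set E4} (hg : IsMetricOn g U) (hV : IsOpen V) (h : V ⊆ U) :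
    IsMetricOn g V where
  isOpen := hV
  smooth i j := (hg.smooth i j).mono h
  symm y hy := hg.symm y (h hy)
  det_ne_zero y hy := hg.det_ne_zero y (h hy)

lemma ginv_rescale (hg : IsMetricOn g U) (hy : y ∈ U) (h0 : f y ≠ 0) (i j : Fin 4) :
    ginv (rescale f g) i j y = (f y ^ 2)⁻¹ * ginv g i j y := by
  have h : (Matrix.of fun a b => rescale f g a b y)⁻¹ =
      (f y ^ 2)⁻¹ • (Matrix.of fun a b => g a b y)⁻¹ := by
    have e : (Matrix.of fun a b => rescale f g a b y) =
        f y ^ 2 • Matrix.of fun a b => g a b y := by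
      ext a b; simp [rescale]
    rw [e]
    refine Matrix.inv_eq_left_inv ?_
    rw [Matrix.smul_mul, Matrix.mul_smul, smul_smul,
      Matrix.nonsing_inv_mul _ (isUnit_iff_ne_zero.2 (hg.det_ne_zero y hy)),
      inv_mul_cancel₀ (pow_ne_zero 2 h0), one_smul]
  unfold ginv
  rw [h]; rfl

lemma trace_rescale (hg : IsMetricOn g U) (hy : y ∈ U) (h0 : f y ≠ 0) (t : Comp2) :
    trace (rescale f g) t y = (f y ^ 2)⁻¹ * trace g t y := by
  simp only [trace, ginv_rescale hg hy h0, Finset.mul_sum]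
  exact Finset.sum_congr rfl fun i _ => Finset.sum_congr rfl fun j _ => by ring

lemma contDiffOn_logDer (hU : IsOpen U) (hf : ContDiffOn ℝ ∞ f U) (h0 : ∀ y ∈ U, f y ≠ 0)
    (i : Fin 4) : ContDiffOn ℝ ∞ (logDer f i) U :=
  (contDiffOn_pd hU hf i).div hf h0

lemma pd_logDer (hU : IsOpen U) (hf : ContDiffOn ℝ ∞ f U) (hy : y ∈ U) (h0 : f y ≠ 0)
    (i j : Fin 4) :
    pd i (logDer f j) y = pd i (pd j f) y / f y - logDer f i y * logDer f j y := by
  have hd := differentiableAt_of_contDiffOn hU hf hy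
  have hd' := differentiableAt_of_contDiffOn hU (contDiffOn_pd hU hf j) hy
  have e : logDer f j = fun z => pd j f z * (f z)⁻¹ := by
    funext z; simp [logDer, div_eq_mul_inv]
  have hi : DifferentiableAt ℝ (fun z => (f z)⁻¹) y := hd.inv h0
  rw [show pd i (logDer f j) y = pd i (fun z => pd j f z * (f z)⁻¹) y by rw [e],
    pd_mul i hd' hi, pd_inv i hd h0]
  unfold logDer
  field_simp
  ring

lemma covDeriv1_logDer (hU : IsOpen U) (hf : ContDiffOn ℝ ∞ f U) (hy : y ∈ U) (h0 : f y ≠ 0)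
    (i j : Fin 4) :
    covDeriv1 g (logDer f) i j y = hess g f i j y / f y - logDer f i y * logDer f j y := by
  unfold covDeriv1 hess
  rw [pd_logDer hU hf hy h0, sub_div, Finset.sum_div]
  have : ∀ m, christoffel g m i j y * logDer f m y =
      christoffel g m i j y * pd m f y / f y := fun m => by unfold logDer; ring
  simp_rw [this]
  ring

lemma normSq_logDer : normSq g (logDer f) y = gradSq g f y / f y ^ 2 := by
  rw [gradSq_eq_normSq]
  unfold normSq raise logDer
  rw [Finset.sum_div]
  refine Finset.sum_congr rfl fun m _ => ?_
  rw [Finset.sum_mul, Finset.sum_mul, Finset.sum_div]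
  exact Finset.sum_congr rfl fun l _ => by ring

lemma christoffel_rescale (hg : IsMetricOn g U) (hf : ContDiffOn ℝ ∞ f U) (hy : y ∈ U)
    (h0 : f y ≠ 0) (k i j : Fin 4) :
    christoffel (rescale f g) k i j y = christoffel g k i j y
      + ((if k = i then logDer f j y else 0) + (if k = j then logDer f i y else 0)
        - g i j y * raise g (logDer f) k y) := by
  have hd := differentiableAt_of_contDiffOn hg.isOpen hf hy
  have hdg : ∀ a b, DifferentiableAt ℝ (g a b) y := fun a b =>
    differentiableAt_of_contDiffOn hg.isOpen (hg.smooth a b) hy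
  have hp : ∀ a b c, pd a (rescale f g b c) y =
      2 * f y * pd a f y * g b c y + f y ^ 2 * pd a (g b c) y := by
    intro a b c
    unfold rescale
    rw [pd_mul a (hd.fun_pow 2) (hdg b c), pd_sq a hd]
  have e : ∀ l, ginv (rescale f g) k l y * (pd i (rescale f g l j) y + pd j (rescale f g l i) y
        - pd l (rescale f g i j) y) =
      ginv g k l y * (pd i (g l j) y + pd j (g l i) y - pd l (g i j) y)
      + 2 * (logDer f i y * (ginv g k l y * g l j y)) + 2 * (logDer f j y * (ginv g k l y * g l i y))
      - 2 * (g i j y * (ginv g k l y * logDer f l y)) := by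
    intro l
    rw [ginv_rescale hg hy h0, hp, hp, hp]
    unfold logDer
    field_simp
    ring
  unfold christoffel
  simp only [e, Finset.sum_add_distrib, Finset.sum_sub_distrib, ← Finset.mul_sum,
    sum_ginv_mul hg hy]
  unfold raise
  split_ifs <;> ring

lemma ricci_rescale_logDer (hg : IsMetricOn g U) (hf : ContDiffOn ℝ ∞ f U)
    (h0 : ∀ y ∈ U, f y ≠ 0) (hy : y ∈ U) (j l : Fin 4) :
    ricci (rescale f g) j l y = ricci g j l y
      - 2 * (covDeriv1 g (logDer f) j l y - logDer f j y * logDer f l y)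
      - (trace g (covDeriv1 g (logDer f)) y + 2 * normSq g (logDer f) y) * g j l y := by
  have hY := contDiffOn_logDer hg.isOpen hf h0
  have hdY : ∀ a, DifferentiableAt ℝ (logDer f a) y := fun a =>
    differentiableAt_of_contDiffOn hg.isOpen (hY a) hy
  have hdV : ∀ a, DifferentiableAt ℝ (raise g (logDer f) a) y := fun a =>
    differentiableAt_of_contDiffOn hg.isOpen (contDiffOn_raise hg hY a) hy
  have hdg : ∀ a b, DifferentiableAt ℝ (g a b) y := fun a b =>
    differentiableAt_of_contDiffOn hg.isOpen (hg.smooth a b) hy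
  have hdΓ : ∀ a b c, DifferentiableAt ℝ (christoffel g a b c) y := fun a b c =>
    differentiableAt_of_contDiffOn hg.isOpen (contDiffOn_christoffel hg a b c) hy
  have hdite : ∀ (P : Prop) [Decidable P] a,
      DifferentiableAt ℝ (fun z => if P then logDer f a z else 0) y := by
    intro P _ a
    by_cases h : P
    · simpa [h] using hdY a
    · simp [h]
  have hpite : ∀ (P : Prop) [Decidable P] a b,
      pd b (fun z => if P then logDer f a z else 0) y = if P then pd b (logDer f a) y else 0 := by
    intro P _ a b
    by_cases h : P
    · simp only [h, if_true]
    · simp only [h, if_false]; exact pd_const b 0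
  set C : Fin 4 → Fin 4 → Fin 4 → E4 → ℝ := fun k i j z =>
    (if k = i then logDer f j z else 0) + (if k = j then logDer f i z else 0)
        - g i j z * raise g (logDer f) k z with hCdef
  have hdC : ∀ k i j, DifferentiableAt ℝ (C k i j) y := fun k i j =>
    ((hdite _ _).fun_add (hdite _ _)).fun_sub ((hdg _ _).fun_mul (hdV _))
  have hpΓ : ∀ a k i j, pd a (christoffel (rescale f g) k i j) y =
      pd a (christoffel g k i j) y + pd a (C k i j) y := by
    intro a k i j
    rw [← pd_add a (hdΓ k i j) (hdC k i j)]
    exact pd_congr a ((hg.isOpen.eventually_mem hy).mono fun z hz =>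
      christoffel_rescale hg hf hz (h0 z hz) k i j)
  have hpC : ∀ a k i j, pd a (C k i j) y =
      (if k = i then pd a (logDer f j) y else 0) + (if k = j then pd a (logDer f i) y else 0)
      - (pd a (g i j) y * raise g (logDer f) k y
        + g i j y * pd a (raise g (logDer f) k) y) := by
    intro a k i j
    rw [hCdef]
    simp only
    rw [pd_sub a ((hdite _ _).fun_add (hdite _ _)) ((hdg _ _).fun_mul (hdV _)),
      pd_add a (hdite _ _) (hdite _ _), pd_mul a (hdg _ _) (hdV _), hpite, hpite]
  have hlow : ∀ i j, ∑ m, (pd i (g j m) y * raise g (logDer f) m y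
      + g j m y * pd i (raise g (logDer f) m) y) = pd i (logDer f j) y := by
    intro i j
    have : logDer f j =ᶠ[𝓝 y] fun z => ∑ m, g j m z * raise g (logDer f) m z :=
      (hg.isOpen.eventually_mem hy).mono fun z hz => (sum_mul_raise hg hz j).symm
    rw [pd_congr i this, pd_sum i _ fun m _ => (hdg j m).fun_mul (hdV m)]
    exact Finset.sum_congr rfl fun m _ => (pd_mul i (hdg j m) (hdV m)).symm
  have hsymm : ∀ i j, pd i (logDer f j) y = pd j (logDer f i) y := by
    intro i j
    rw [pd_logDer hg.isOpen hf hy (h0 y hy), pd_logDer hg.isOpen hf hy (h0 y hy),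
      pd_comm hg.isOpen hf hy]
    ring
  have key := ricci_change_algebra (Γ := fun k i j => christoffel g k i j y)
    (C := fun k i j => C k i j y) (dC := fun a k i j => pd a (C k i j) y)
    (G := fun i j => g i j y) (dY := fun i j => pd i (logDer f j) y)
    (dV := fun i j => pd i (raise g (logDer f) j) y) (dG := fun k i j => pd k (g i j) y)
    (Y := fun i => logDer f i y) (V := fun i => raise g (logDer f) i y)
    (fun k i j => rfl) hpC (pd_metric hg hy) hlow (sum_mul_raise hg hy) (hg.symm y hy)
    (christoffel_symm hg hy) hsymm j l
  have hdiv := sum_covDeriv_raise hg hY hy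
  unfold ricci
  have e : ∀ k, pd k (christoffel (rescale f g) k j l) y - pd j (christoffel (rescale f g) k k l) y
      + ∑ m, (christoffel (rescale f g) k k m y * christoffel (rescale f g) m j l y
        - christoffel (rescale f g) k j m y * christoffel (rescale f g) m k l y) =
      (pd k (christoffel g k j l) y - pd j (christoffel g k k l) y)
      + (pd k (C k j l) y - pd j (C k k l) y
      + ∑ m, ((christoffel g k k m y + C k k m y) * (christoffel g m j l y + C m j l y)
        - (christoffel g k j m y + C k j m y) * (christoffel g m k l y + C m k l y))) := by
    intro k
    rw [hpΓ, hpΓ]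
    have hx := christoffel_rescale hg hf hy (h0 y hy)
    simp only [hx, hCdef]
    ring
  simp_rw [e]
  rw [Finset.sum_add_distrib, key, hdiv, Finset.sum_add_distrib]
  unfold covDeriv1 normSq
  ring

/-- Conformal change of the Ricci tensor; the trace of the Hessian is the wave operator `□ f`. -/
lemma ricci_rescale (hg : IsMetricOn g U) (hf : ContDiffOn ℝ ∞ f U)
    (h0 : ∀ y ∈ U, f y ≠ 0) (hy : y ∈ U) (i j : Fin 4) :
    f y ^ 2 * ricci (rescale f g) i j y = f y ^ 2 * ricci g i j y - 2 * f y * hess g f i j y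
      + 4 * pd i f y * pd j f y
      - (f y * trace g (hess g f) y + gradSq g f y) * g i j y := by
  have hf0 := h0 y hy
  have htr : trace g (covDeriv1 g (logDer f)) y =
      trace g (hess g f) y / f y - gradSq g f y / f y ^ 2 := by
    simp only [trace, gradSq, covDeriv1_logDer hg.isOpen hf hy hf0, Finset.sum_div,
      ← Finset.sum_sub_distrib]
    refine Finset.sum_congr rfl fun a _ => Finset.sum_congr rfl fun b _ => ?_
    unfold logDer
    field_simp
  rw [ricci_rescale_logDer hg hf h0 hy, covDeriv1_logDer hg.isOpen hf hy hf0, normSq_logDer, htr]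
  unfold logDer
  field_simp
  ring

lemma scalarCurv_rescale (hg : IsMetricOn g U) (hf : ContDiffOn ℝ ∞ f U)
    (h0 : ∀ y ∈ U, f y ≠ 0) (hy : y ∈ U) :
    f y ^ 4 * scalarCurv (rescale f g) y =
      f y ^ 2 * scalarCurv g y - 6 * f y * trace g (hess g f) y := by
  have hf0 := h0 y hy
  have h1 : f y ^ 4 * scalarCurv (rescale f g) y =
      ∑ i, ∑ j, ginv g i j y * (f y ^ 2 * ricci (rescale f g) i j y) := by
    unfold scalarCurv
    rw [trace_rescale hg hy hf0]
    simp only [trace, Finset.mul_sum]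
    refine Finset.sum_congr rfl fun i _ => Finset.sum_congr rfl fun j _ => ?_
    field_simp
  have h2 : ∀ i j, ginv g i j y * (f y ^ 2 * ricci (rescale f g) i j y) =
      f y ^ 2 * (ginv g i j y * ricci g i j y) - 2 * f y * (ginv g i j y * hess g f i j y)
      + 4 * (ginv g i j y * pd i f y * pd j f y)
      - (f y * trace g (hess g f) y + gradSq g f y) * (ginv g i j y * g i j y) := by
    intro i j; rw [ricci_rescale hg hf h0 hy]; ring
  have h3 := trace_self hg hy
  rw [h1]
  simp only [h2, Finset.sum_add_distrib, Finset.sum_sub_distrib, ← Finset.mul_sum]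
  unfold scalarCurv
  change f y ^ 2 * trace g (ricci g) y - 2 * f y * trace g (hess g f) y + 4 * gradSq g f y
    - (f y * trace g (hess g f) y + gradSq g f y) * trace g g y = _
  rw [h3]; ring

/-- Conformal change of the Schouten tensor. -/
lemma schouten_rescale (hg : IsMetricOn g U) (hf : ContDiffOn ℝ ∞ f U)
    (h0 : ∀ y ∈ U, f y ≠ 0) (hy : y ∈ U) (i j : Fin 4) :
    f y ^ 2 * schouten (rescale f g) i j y = f y ^ 2 * schouten g i j y - f y * hess g f i j y
      + 2 * pd i f y * pd j f y - (1 / 2) * gradSq g f y * g i j y := by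
  have h1 := ricci_rescale hg hf h0 hy i j
  have h2 := scalarCurv_rescale hg hf h0 hy
  unfold schouten
  change f y ^ 2 * (1 / 2 * (ricci (rescale f g) i j y
    - 1 / 6 * scalarCurv (rescale f g) y * (f y ^ 2 * g i j y))) = _
  linear_combination (1 / 2) * h1 - (1 / 12) * g i j y * h2

/-- The energy-momentum tensor of the conformal scalar field `f` on `(U, g)` is, up to the factor
`2 f²`, the tensor `L_{ij} - mu g_{ij}` of the metric `f² g`. In particular it is conformally
covariant, `f² g` being invariant under `g ↦ Ω² g`, `f ↦ Ω⁻¹ f`. -/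
lemma scalarEMT_eq_schouten_rescale (hg : IsMetricOn g U) (hf : ContDiffOn ℝ ∞ f U)
    (h0 : ∀ y ∈ U, f y ≠ 0) (hy : y ∈ U) (ε mu : ℝ) (i j : Fin 4) :
    scalarEMT ε mu g f i j y =
      ε * (2 * f y ^ 2 * (schouten (rescale f g) i j y - mu * (f y ^ 2 * g i j y))) := by
  have h := schouten_rescale hg hf h0 hy i j
  unfold scalarEMT
  linear_combination -2 * ε * h

/-! ### Consequences of the field equations -/

lemma trace_schouten (hg : IsMetricOn g U) (hy : y ∈ U) :
    trace g (schouten g) y = scalarCurv g y / 6 := by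
  have h : ∀ i j, ginv g i j y * schouten g i j y = (1 / 2) * (ginv g i j y * ricci g i j y)
      - (1 / 12) * scalarCurv g y * (ginv g i j y * g i j y) := by
    intro i j; unfold schouten; ring
  unfold trace
  simp only [h, Finset.sum_sub_distrib, ← Finset.mul_sum]
  change 1 / 2 * scalarCurv g y - 1 / 12 * scalarCurv g y * trace g g y = _
  rw [trace_self hg hy]; ring

lemma trace_einstein (hg : IsMetricOn g U) (hy : y ∈ U) :
    trace g (einstein g) y = - scalarCurv g y := by
  have h : ∀ i j, ginv g i j y * einstein g i j y = ginv g i j y * ricci g i j y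
      - (1 / 2) * scalarCurv g y * (ginv g i j y * g i j y) := by
    intro i j; unfold einstein; ring
  unfold trace
  simp only [h, Finset.sum_sub_distrib, ← Finset.mul_sum]
  change scalarCurv g y - 1 / 2 * scalarCurv g y * trace g g y = _
  rw [trace_self hg hy]; ring

/-- The energy-momentum tensor of a conformal scalar field is trace-free. -/
lemma trace_scalarEMT (hg : IsMetricOn g U) (hy : y ∈ U) (ε : ℝ) {mu : ℝ}
    (hw : WaveEq mu g f y) : trace g (scalarEMT ε mu g f) y = 0 := by
  have h : ∀ i j, ginv g i j y * scalarEMT ε mu g f i j y =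
      4 * ε * (ginv g i j y * pd i f y * pd j f y)
      - ε * gradSq g f y * (ginv g i j y * g i j y)
      - 2 * ε * f y * (ginv g i j y * hess g f i j y)
      + 2 * ε * f y ^ 2 * (ginv g i j y * schouten g i j y)
      - 2 * ε * mu * f y ^ 4 * (ginv g i j y * g i j y) := by
    intro i j; unfold scalarEMT; ring
  unfold WaveEq at hw
  have e : trace g (scalarEMT ε mu g f) y = 4 * ε * gradSq g f y
      - ε * gradSq g f y * trace g g y - 2 * ε * f y * trace g (hess g f) y
      + 2 * ε * f y ^ 2 * trace g (schouten g) y - 2 * ε * mu * f y ^ 4 * trace g g y := by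
    unfold trace
    simp only [h, Finset.sum_add_distrib, Finset.sum_sub_distrib, ← Finset.mul_sum]
    rfl
  rw [e, trace_self hg hy]
  linear_combination (-2 * ε * f y) * hw

/-- By the wave equation, the metric `f² g` has constant scalar curvature `24 mu`. -/
lemma scalarCurv_rescale_eq (hg : IsMetricOn g U) (hf : ContDiffOn ℝ ∞ f U)
    (h0 : ∀ y ∈ U, f y ≠ 0) (hy : y ∈ U) {mu : ℝ} (hw : WaveEq mu g f y) :
    scalarCurv (rescale f g) y = 24 * mu := by
  have h1 := scalarCurv_rescale hg hf h0 hy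
  have h2 := trace_schouten hg hy
  unfold WaveEq at hw
  rw [h2] at hw
  have h3 : f y ^ 4 ≠ 0 := pow_ne_zero 4 (h0 y hy)
  refine mul_left_cancel₀ h3 ?_
  linear_combination h1 - 6 * f y * hw

/-- By the wave equation, the Ricci tensor of `f² g` is, up to a multiple of the metric, the
energy-momentum tensor of `f` divided by `f²`. -/
lemma ricci_rescale_eq_scalarEMT (hg : IsMetricOn g U) (hf : ContDiffOn ℝ ∞ f U)
    (h0 : ∀ y ∈ U, f y ≠ 0) (hy : y ∈ U) {ε mu : ℝ} (hε : ε = 1 ∨ ε = -1)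
    (hw : WaveEq mu g f y) (i j : Fin 4) :
    ricci (rescale f g) i j y =
      ε * (f y ^ 2)⁻¹ * scalarEMT ε mu g f i j y + 6 * mu * (f y ^ 2 * g i j y) := by
  have h1 := scalarCurv_rescale_eq hg hf h0 hy hw
  have h2 := scalarEMT_eq_schouten_rescale hg hf h0 hy ε mu i j
  have hε2 : ε * ε = 1 := by rcases hε with rfl | rfl <;> norm_num
  have h3 : f y ^ 2 ≠ 0 := pow_ne_zero 2 (h0 y hy)
  have h4 : schouten (rescale f g) i j y = 1 / 2 * (ricci (rescale f g) i j y
    - 1 / 6 * scalarCurv (rescale f g) y * (f y ^ 2 * g i j y)) := rfl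
  rw [h2, h4, h1]
  have : ε * (f y ^ 2)⁻¹ * (ε * (2 * f y ^ 2 * (1 / 2 * (ricci (rescale f g) i j y
      - 1 / 6 * (24 * mu) * (f y ^ 2 * g i j y)) - mu * (f y ^ 2 * g i j y)))) =
      (ε * ε) * ((f y ^ 2)⁻¹ * f y ^ 2) * (2 * (1 / 2 * (ricci (rescale f g) i j y
      - 1 / 6 * (24 * mu) * (f y ^ 2 * g i j y)) - mu * (f y ^ 2 * g i j y))) := by ring
  rw [this, hε2, inv_mul_cancel₀ h3]
  ring

/-- If `G + 6 lam g = T` with trace-free `T`, then `2 (L - lam g) = T`. -/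
lemma schouten_of_einstein_eq (hg : IsMetricOn g U) (hy : y ∈ U) {t : Comp2} {lam : ℝ}
    (ht : trace g t y = 0) (hE : ∀ i j, einstein g i j y + 6 * lam * g i j y = t i j y)
    (i j : Fin 4) : 2 * (schouten g i j y - lam * g i j y) = t i j y := by
  have h1 : trace g t y = trace g (einstein g) y + 6 * lam * trace g g y := by
    simp only [trace, ← hE, Finset.mul_sum, ← Finset.sum_add_distrib]
    exact Finset.sum_congr rfl fun i _ => Finset.sum_congr rfl fun j _ => by ring
  rw [ht, trace_einstein hg hy, trace_self hg hy] at h1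
  have h2 := hE i j
  unfold einstein at h2
  unfold schouten
  linear_combination h2 + (1 / 3) * g i j y * h1

/-- The energy-momentum tensor of the dual scalar field `f⁻¹` on the dual spacetime `f² g`. -/
lemma scalarEMT_dual (hg : IsMetricOn g U) (hf : ContDiffOn ℝ ∞ f U)
    (h0 : ∀ y ∈ U, f y ≠ 0) (hy : y ∈ U) {t : Comp2} {lam : ℝ} (ε : ℝ)
    (ht : trace g t y = 0) (hE : ∀ i j, einstein g i j y + 6 * lam * g i j y = t i j y)
    (i j : Fin 4) :
    scalarEMT ε lam (rescale f g) (fun z => (f z)⁻¹) i j y = ε * (f y ^ 2)⁻¹ * t i j y := by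
  have hf' : ContDiffOn ℝ ∞ (fun z => (f z)⁻¹) U := hf.inv h0
  have h0' : ∀ z ∈ U, (f z)⁻¹ ≠ 0 := fun z hz => inv_ne_zero (h0 z hz)
  rw [scalarEMT_eq_schouten_rescale (hg.rescale hf h0) hf' h0' hy]
  have hcongr : ∀ i j, rescale (fun z => (f z)⁻¹) (rescale f g) i j =ᶠ[𝓝 y] g i j := by
    intro i j
    refine (hg.isOpen.eventually_mem hy).mono fun z hz => ?_
    have := h0 z hz
    simp only [rescale]
    field_simp
  rw [schouten_congr hcongr, ← schouten_of_einstein_eq hg hy ht hE i j]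
  have := h0 y hy
  simp only [rescale]
  field_simp

end ConformalChange

/-! ### The linear system for the inverse conformal factor -/

section Prolongation

variable {V : Set E4} {g : Comp2} {f : E4 → ℝ} {y : E4}

/-- The difference of the Schouten tensors of `g` and `f² g`. -/
def schoutenDiff (f : E4 → ℝ) (g : Comp2) : Comp2 := fun i j y =>
  schouten g i j y - schouten (rescale f g) i j y

/-- The Riccati equation for the logarithmic derivative of the conformal factor. -/
lemma covDeriv1_logDer_eq (hg : IsMetricOn g V) (hf : ContDiffOn ℝ ∞ f V)
    (h0 : ∀ y ∈ V, f y ≠ 0) (hy : y ∈ V) (i j : Fin 4) :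
    covDeriv1 g (logDer f) i j y = schoutenDiff f g i j y + logDer f i y * logDer f j y
      - (1 / 2) * normSq g (logDer f) y * g i j y := by
  have h := schouten_rescale hg hf h0 hy i j
  have hf0 := h0 y hy
  rw [covDeriv1_logDer hg.isOpen hf hy hf0, normSq_logDer]
  unfold schoutenDiff logDer
  field_simp
  linear_combination 2 * h

/-- The covector `∂ⱼ f / f²`, which is `- ∂ⱼ (f⁻¹)`. -/
def invGrad (f : E4 → ℝ) : Comp1 := fun j y => (f y)⁻¹ * logDer f j y

/-- The function `|du|² / (2 u)` for `u = f⁻¹`. -/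
def invDensity (g : Comp2) (f : E4 → ℝ) : E4 → ℝ := fun y =>
  (1 / 2) * ((f y)⁻¹ * normSq g (logDer f) y)

lemma pd_inv_eq (hV : IsOpen V) (hf : ContDiffOn ℝ ∞ f V)
    (h0 : ∀ y ∈ V, f y ≠ 0) (hy : y ∈ V) (k : Fin 4) :
    pd k (fun z => (f z)⁻¹) y = - invGrad f k y := by
  have hf0 := h0 y hy
  rw [pd_inv k (differentiableAt_of_contDiffOn hV hf hy) hf0]
  unfold invGrad logDer
  field_simp

/-- The equation `∇_k ∇_j u = - Q_{kj} u + w g_{kj}` for `u = f⁻¹`, where `Q` is the difference of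
the Schouten tensors and `w = |du|² / (2 u)`. -/
lemma pd_invGrad (hg : IsMetricOn g V) (hf : ContDiffOn ℝ ∞ f V)
    (h0 : ∀ y ∈ V, f y ≠ 0) (hy : y ∈ V) (k j : Fin 4) :
    pd k (invGrad f j) y = (f y)⁻¹ * schoutenDiff f g k j y - invDensity g f y * g k j y
      + ∑ m, christoffel g m k j y * invGrad f m y := by
  have hd : DifferentiableAt ℝ (fun z => (f z)⁻¹) y :=
    (differentiableAt_of_contDiffOn hg.isOpen hf hy).inv (h0 y hy)
  have hd' := differentiableAt_of_contDiffOn hg.isOpen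
    (contDiffOn_logDer hg.isOpen hf h0 j) hy
  have h1 := covDeriv1_logDer_eq hg hf h0 hy k j
  unfold covDeriv1 at h1
  have h2 : ∑ m, christoffel g m k j y * invGrad f m y =
      (f y)⁻¹ * ∑ m, christoffel g m k j y * logDer f m y := by
    rw [Finset.mul_sum]
    exact Finset.sum_congr rfl fun m _ => by unfold invGrad; ring
  have h3 : pd k (invGrad f j) y = _ := pd_mul k hd hd'
  rw [h3, pd_inv_eq hg.isOpen hf h0 hy, h2]
  unfold invGrad invDensity
  linear_combination (f y)⁻¹ * h1

/-- The equation `∂_k w = - Q_{kj} ∇^j u` closes the system: the terms quadratic in `du` cancel. -/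
lemma pd_invDensity (hg : IsMetricOn g V) (hf : ContDiffOn ℝ ∞ f V)
    (h0 : ∀ y ∈ V, f y ≠ 0) (hy : y ∈ V) (k : Fin 4) :
    pd k (invDensity g f) y =
      ∑ j, ∑ l, ginv g j l y * invGrad f l y * schoutenDiff f g k j y := by
  have hY := contDiffOn_logDer hg.isOpen hf h0
  have hd : DifferentiableAt ℝ (fun z => (f z)⁻¹) y :=
    (differentiableAt_of_contDiffOn hg.isOpen hf hy).inv (h0 y hy)
  have hs : ContDiffOn ℝ ∞ (normSq g (logDer f)) V :=
    ContDiffOn.sum (s := Finset.univ) fun m _ => (contDiffOn_raise hg hY m).mul (hY m)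
  have hd' := differentiableAt_of_contDiffOn hg.isOpen hs hy
  have h1 : pd k (invDensity g f) y = _ := pd_const_mul k (1 / 2) (hd.fun_mul hd')
  have h2 : ∑ j, raise g (logDer f) j y * covDeriv1 g (logDer f) k j y =
      ∑ j, raise g (logDer f) j y * schoutenDiff f g k j y
        + (1 / 2) * logDer f k y * normSq g (logDer f) y := by
    have e : ∀ j, raise g (logDer f) j y * covDeriv1 g (logDer f) k j y =
        raise g (logDer f) j y * schoutenDiff f g k j y
        + logDer f k y * (raise g (logDer f) j y * logDer f j y)
        - (1 / 2) * normSq g (logDer f) y * (g k j y * raise g (logDer f) j y) := by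
      intro j; rw [covDeriv1_logDer_eq hg hf h0 hy]; ring
    simp only [e, Finset.sum_add_distrib, Finset.sum_sub_distrib, ← Finset.mul_sum,
      sum_mul_raise hg hy]
    change _ + logDer f k y * normSq g (logDer f) y - _ = _
    ring
  have h3 : ∑ j, ∑ l, ginv g j l y * invGrad f l y * schoutenDiff f g k j y =
      (f y)⁻¹ * ∑ j, raise g (logDer f) j y * schoutenDiff f g k j y := by
    unfold raise invGrad
    simp only [Finset.mul_sum, Finset.sum_mul]
    exact Finset.sum_congr rfl fun j _ => Finset.sum_congr rfl fun l _ => by ring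
  rw [h1, pd_mul k hd hd', pd_inv_eq hg.isOpen hf h0 hy, pd_normSq hg hY hy, h2, h3]
  unfold invGrad
  ring

lemma abs_sum_le {n : ℕ} {F : Fin n → ℝ} {b : ℝ} (h : ∀ k, |F k| ≤ b) : |∑ k, F k| ≤ n * b := by
  refine (Finset.abs_sum_le_sum_abs _ _).trans ?_
  simpa using Finset.sum_le_sum fun k (_ : k ∈ Finset.univ) => h k

/-- If the curvature of `f² g` stays bounded along a curve in a region where `g` is regular, then
`f` stays away from zero: `u = f⁻¹`, its gradient and `|du|² / (2 u)` satisfy a linear system of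
ordinary differential equations with bounded coefficients along the curve. -/
lemma inv_bounded_along_curve (hg : IsMetricOn g V) (hf : ContDiffOn ℝ ∞ f V)
    (h0 : ∀ y ∈ V, f y ≠ 0) {a b B : ℝ} {x x' : ℝ → E4}
    (hx : ∀ s ∈ Ico a b, HasDerivAt x (x' s) s) (hxV : ∀ s ∈ Ico a b, x s ∈ V)
    (hx' : ∀ s ∈ Ico a b, ∀ k, |x' s k| ≤ B)
    (hgB : ∀ s ∈ Ico a b, ∀ i j, |g i j (x s)| ≤ B)
    (hiB : ∀ s ∈ Ico a b, ∀ i j, |ginv g i j (x s)| ≤ B)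
    (hΓB : ∀ s ∈ Ico a b, ∀ k i j, |christoffel g k i j (x s)| ≤ B)
    (hQB : ∀ s ∈ Ico a b, ∀ i j, |schoutenDiff f g i j (x s)| ≤ B) :
    ∃ N, ∀ s ∈ Ico a b, |(f (x s))⁻¹| ≤ N := by
  rcases le_or_gt b a with hab | hab
  · exact ⟨0, fun s hs => absurd (hs.1.trans_lt hs.2) (not_lt.2 hab)⟩
  have hB : 0 ≤ B := (abs_nonneg _).trans (hx' a ⟨le_rfl, hab⟩ 0)
  set F : ℝ → ℝ × (Fin 4 → ℝ) × ℝ := fun s =>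
    ((f (x s))⁻¹, (fun j => invGrad f j (x s)), invDensity g f (x s)) with hF
  set F' : ℝ → ℝ × (Fin 4 → ℝ) × ℝ := fun s =>
    (∑ k, x' s k * pd k (fun z => (f z)⁻¹) (x s),
      (fun j => ∑ k, x' s k * pd k (invGrad f j) (x s)),
      ∑ k, x' s k * pd k (invDensity g f) (x s)) with hF'
  have hY := contDiffOn_logDer hg.isOpen hf h0
  have hi : ContDiffOn ℝ ∞ (fun z => (f z)⁻¹) V := hf.inv h0
  have hG : ∀ j, ContDiffOn ℝ ∞ (invGrad f j) V := fun j => hi.mul (hY j)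
  have hD : ContDiffOn ℝ ∞ (invDensity g f) V :=
    contDiffOn_const.mul (hi.mul (ContDiffOn.sum (s := Finset.univ) fun m _ =>
      (contDiffOn_raise hg hY m).mul (hY m)))
  have hder : ∀ s ∈ Ico a b, HasDerivAt F (F' s) s := by
    intro s hs
    have hd : ∀ {h : E4 → ℝ}, ContDiffOn ℝ ∞ h V → DifferentiableAt ℝ h (x s) := fun hh =>
      differentiableAt_of_contDiffOn hg.isOpen hh (hxV s hs)
    exact (hasDerivAt_comp_curve (hx s hs) (hd hi)).prodMk
      ((hasDerivAt_pi.2 fun j => hasDerivAt_comp_curve (hx s hs) (hd (hG j))).prodMk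
        (hasDerivAt_comp_curve (hx s hs) (hd hD)))
  -- the sum of the operator bounds for the three components of the system
  set K : ℝ := 4 * B + 24 * B ^ 2 + 64 * B ^ 3 with hK
  have hbound : ∀ s ∈ Ico a b, ‖F' s‖ ≤ K * ‖F s‖ := by
    intro s hs
    set n := ‖F s‖ with hn
    have hn0 : 0 ≤ n := norm_nonneg _
    have n1 : |(f (x s))⁻¹| ≤ n := norm_fst_le (F s)
    have n2' : ‖(F s).2.1‖ ≤ n := (norm_fst_le (F s).2).trans (norm_snd_le (F s))
    have n2 : ∀ j, |invGrad f j (x s)| ≤ n := fun j => (norm_le_pi_norm (F s).2.1 j).trans n2'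
    have n3 : |invDensity g f (x s)| ≤ n := (norm_snd_le (F s).2).trans (norm_snd_le (F s))
    have b1 : 0 ≤ B * n := by positivity
    have b2 : 0 ≤ B ^ 2 * n := by positivity
    have b3 : 0 ≤ B ^ 3 * n := by positivity
    have hm : ∀ {p q c d : ℝ}, |p| ≤ c → |q| ≤ d → |p * q| ≤ c * d := fun {p q c d} hp hq => by
      rw [abs_mul]
      exact mul_le_mul hp hq (abs_nonneg _) ((abs_nonneg _).trans hp)
    have hxs := hxV s hs
    have e1 : |(F' s).1| ≤ K * n := by
      have : |∑ k, x' s k * pd k (fun z => (f z)⁻¹) (x s)| ≤ (4 : ℕ) * (B * n) := by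
        refine abs_sum_le fun k => ?_
        rw [pd_inv_eq hg.isOpen hf h0 hxs]
        exact hm (hx' s hs k) (by rw [abs_neg]; exact n2 k)
      refine this.trans ?_
      rw [hK]; push_cast; nlinarith
    have e2 : ∀ j, |(F' s).2.1 j| ≤ K * n := by
      intro j
      have : |∑ k, x' s k * pd k (invGrad f j) (x s)| ≤
          (4 : ℕ) * (B * (n * B + n * B + (4 : ℕ) * (B * n))) := by
        refine abs_sum_le fun k => hm (hx' s hs k) ?_
        rw [pd_invGrad hg hf h0 hxs]
        refine (abs_add_le _ _).trans (add_le_add ((abs_sub _ _).trans (add_le_add ?_ ?_)) ?_)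
        · exact hm n1 (hQB s hs k j)
        · exact hm n3 (hgB s hs k j)
        · exact abs_sum_le fun m => hm (hΓB s hs m k j) (n2 m)
      refine this.trans ?_
      rw [hK]; push_cast; nlinarith
    have e3 : |(F' s).2.2| ≤ K * n := by
      have : |∑ k, x' s k * pd k (invDensity g f) (x s)| ≤
          (4 : ℕ) * (B * ((4 : ℕ) * ((4 : ℕ) * (B * n * B)))) := by
        refine abs_sum_le fun k => hm (hx' s hs k) ?_
        rw [pd_invDensity hg hf h0 hxs]
        exact abs_sum_le fun j => abs_sum_le fun l =>
          hm (hm (hiB s hs j l) (n2 l)) (hQB s hs k j)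
      refine this.trans ?_
      rw [hK]; push_cast; nlinarith
    have hKn : 0 ≤ K * n := by positivity
    exact norm_prod_le_iff.2 ⟨e1, norm_prod_le_iff.2 ⟨(pi_norm_le_iff_of_nonneg hKn).2 e2, e3⟩⟩
  have hK0 : 0 ≤ K := by positivity
  refine ⟨gronwallBound ‖F a‖ K 0 (b - a), fun s hs => ?_⟩
  have hsub : ∀ t ∈ Icc a s, t ∈ Ico a b := fun t ht => ⟨ht.1, ht.2.trans_lt hs.2⟩
  have hgr := norm_le_gronwallBound_of_norm_deriv_right_le (f := F) (f' := F') (δ := ‖F a‖)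
    (K := K) (ε := 0) (a := a) (b := s)
    (fun t ht => (hder t (hsub t ht)).continuousAt.continuousWithinAt)
    (fun t ht => (hder t (hsub t ⟨ht.1, ht.2.le⟩)).hasDerivWithinAt) le_rfl
    (fun t ht => by simpa using hbound t (hsub t ⟨ht.1, ht.2.le⟩)) s ⟨hs.1, le_rfl⟩
  have n1 : |(f (x s))⁻¹| ≤ ‖F s‖ := norm_fst_le (F s)
  exact n1.trans (hgr.trans (gronwallBound_mono (norm_nonneg _) le_rfl hK0
    (sub_le_sub_right hs.2.le a)))

lemma exists_abs_le_of_isCompact {ι : Type*} [Finite ι] {K : Set E4} (hK : IsCompact K)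
    {F : ι → E4 → ℝ} (hF : ∀ i, ContinuousOn (F i) K) : ∃ B, ∀ i, ∀ y ∈ K, |F i y| ≤ B := by
  cases nonempty_fintype ι
  choose B hB using fun i => hK.exists_bound_of_continuousOn (hF i)
  refine ⟨∑ i, |B i|, fun i y hy => (hB i y hy).trans ((le_abs_self _).trans ?_)⟩
  exact Finset.single_le_sum (f := fun i => |B i|) (fun i _ => abs_nonneg _) (Finset.mem_univ i)

/-- A metric `f² g` of constant scalar curvature, with `g` regular on the compact set `K`, has
unbounded Ricci tensor along each curve in `K` on which `f` tends to zero. -/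
lemma not_ricci_bounded_along_curve {W K : Set E4} (hW : IsMetricOn g W) (hK : IsCompact K)
    (hKW : K ⊆ W) (hV : IsOpen V) (hVW : V ⊆ W) (hf : ContDiffOn ℝ ∞ f V)
    (h0 : ∀ y ∈ V, f y ≠ 0) {r : ℝ} (hr : ∀ y ∈ V, scalarCurv (rescale f g) y = r)
    {a b D C : ℝ} (hab : a < b) {x x' : ℝ → E4}
    (hx : ∀ s ∈ Ico a b, HasDerivAt x (x' s) s) (hxV : ∀ s ∈ Ico a b, x s ∈ V)
    (hxK : ∀ s ∈ Ico a b, x s ∈ K) (hx' : ∀ s ∈ Ico a b, ∀ k, |x' s k| ≤ D)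
    (hf1 : ∀ s ∈ Ico a b, |f (x s)| ≤ 1)
    (hC : ∀ s ∈ Ico a b, ∀ i j, |ricci (rescale f g) i j (x s)| ≤ C) :
    ¬ Tendsto (fun s => f (x s)) (𝓝[<] b) (𝓝 0) := by
  intro hlim
  obtain ⟨B₁, hB₁⟩ := exists_abs_le_of_isCompact hK (F := fun p : Fin 4 × Fin 4 => g p.1 p.2)
    fun p => ((hW.smooth _ _).continuousOn).mono hKW
  obtain ⟨B₂, hB₂⟩ := exists_abs_le_of_isCompact hK (F := fun p : Fin 4 × Fin 4 => ginv g p.1 p.2)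
    fun p => ((contDiffOn_ginv hW _ _).continuousOn).mono hKW
  obtain ⟨B₃, hB₃⟩ := exists_abs_le_of_isCompact hK
    (F := fun p : Fin 4 × Fin 4 × Fin 4 => christoffel g p.1 p.2.1 p.2.2)
    fun p => ((contDiffOn_christoffel hW _ _ _).continuousOn).mono hKW
  obtain ⟨B₄, hB₄⟩ := exists_abs_le_of_isCompact hK
    (F := fun p : Fin 4 × Fin 4 => schouten g p.1 p.2)
    fun p => ((contDiffOn_schouten hW _ _).continuousOn).mono hKW
  set B₅ : ℝ := 1 / 2 * (C + 1 / 6 * |r| * |B₁|) with hB₅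
  set B : ℝ := |B₁| + |B₂| + |B₃| + (|B₄| + |B₅|) + |D| with hBdef
  have p1 := abs_nonneg B₁
  have p2 := abs_nonneg B₂
  have p3 := abs_nonneg B₃
  have p4 := abs_nonneg B₄
  have p5 := abs_nonneg B₅
  have p6 := abs_nonneg D
  obtain ⟨N, hN⟩ := inv_bounded_along_curve (hW.mono hV hVW) hf h0 (B := B) hx hxV
    (fun s hs k => (hx' s hs k).trans ((le_abs_self D).trans (by linarith)))
    (fun s hs i j => (hB₁ (i, j) _ (hxK s hs)).trans ((le_abs_self _).trans (by linarith)))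
    (fun s hs i j => (hB₂ (i, j) _ (hxK s hs)).trans ((le_abs_self _).trans (by linarith)))
    (fun s hs k i j => (hB₃ (k, i, j) _ (hxK s hs)).trans ((le_abs_self _).trans (by linarith)))
    (fun s hs i j => by
      have h1 : |schouten (rescale f g) i j (x s)| ≤ B₅ := by
        have e : schouten (rescale f g) i j (x s) = 1 / 2 * (ricci (rescale f g) i j (x s)
            - 1 / 6 * r * (f (x s) ^ 2 * g i j (x s))) := by
          rw [← hr (x s) (hxV s hs)]; rfl
        have h2 : |f (x s) ^ 2 * g i j (x s)| ≤ |B₁| := by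
          rw [abs_mul, abs_pow]
          have h3 : |f (x s)| ^ 2 ≤ 1 := pow_le_one₀ (abs_nonneg _) (hf1 s hs)
          have h4 := (hB₁ (i, j) _ (hxK s hs)).trans (le_abs_self _)
          calc |f (x s)| ^ 2 * |g i j (x s)| ≤ 1 * |B₁| :=
                mul_le_mul h3 h4 (abs_nonneg _) zero_le_one
            _ = |B₁| := one_mul _
        rw [e, hB₅, abs_mul, abs_of_pos (by norm_num : (0 : ℝ) < 1 / 2)]
        refine mul_le_mul_of_nonneg_left ((abs_sub _ _).trans (add_le_add (hC s hs i j) ?_))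
          (by norm_num)
        rw [abs_mul, abs_mul, abs_of_pos (by norm_num : (0 : ℝ) < 1 / 6)]
        exact mul_le_mul_of_nonneg_left h2 (by positivity)
      have h2 := (hB₄ (i, j) _ (hxK s hs)).trans (le_abs_self _)
      have h3 := le_abs_self B₅
      refine (abs_sub _ _).trans ((add_le_add h2 h1).trans ?_)
      linarith)
  -- `|f|` is bounded below by `1 / (|N| + 1)` along the curve
  have hev : ∀ᶠ s in 𝓝[<] b, |f (x s)| < (|N| + 1)⁻¹ := by
    have := hlim.abs
    rw [abs_zero] at this
    exact this.eventually_lt_const (by positivity)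
  have hev2 : ∀ᶠ s in 𝓝[<] b, s ∈ Ico a b := Ico_mem_nhdsLT hab
  obtain ⟨s, hs1, hs2⟩ := (hev.and hev2).exists
  have h1 := hN s hs2
  rw [abs_inv] at h1
  have hpos : 0 < |f (x s)| := abs_pos.2 (h0 _ (hxV s hs2))
  have h2 : |N| + 1 < |f (x s)|⁻¹ := (lt_inv_comm₀ hpos (by positivity)).1 hs1
  linarith [le_abs_self N]

end Prolongation

/-! ### Tensor fields in coordinates -/

section Coordinates

variable {M : Type*} [TopologicalSpace M] {e : OpenPartialHomeomorph M E4} {U : Set M} {y : E4}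

lemma isOpen_region (hU : IsOpen U) : IsOpen (region e U) := e.isOpen_inter_preimage_symm hU

lemma region_mono {V : Set M} (h : U ⊆ V) : region e U ⊆ region e V :=
  inter_subset_inter_right _ (preimage_mono h)

lemma mem_region {x : M} (hx : x ∈ e.source) (hxU : x ∈ U) : e x ∈ region e U :=
  ⟨e.map_source hx, by simpa [e.left_inv hx] using hxU⟩

variable [ChartedSpace E4 M]

lemma contDiffOn_comp0 {f : M → ℝ} (hf : ContMDiffOn (𝓡 4) 𝓘(ℝ, ℝ) ∞ f U) (he : e ∈ Charts M) :
    ContDiffOn ℝ ∞ (comp0 f e) (region e U) := by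
  have h : ContMDiffOn (𝓡 4) 𝓘(ℝ, ℝ) ∞ (f ∘ e.symm) (region e U) :=
    hf.comp ((contMDiffOn_symm_of_mem_maximalAtlas he).mono inter_subset_left)
      inter_subset_right
  exact contMDiffOn_iff_contDiffOn.1 h

lemma apply_sum_coordVec (t : TensorField2 M) (a b : Fin 4 → ℝ) :
    t (e.symm y) (∑ i, a i • coordVec e i y) (∑ i, b i • coordVec e i y) =
      ∑ i, ∑ j, a i * b j * comp2 t e i j y := by
  simp only [map_sum, map_smul, sum_apply, smul_apply,
    smul_eq_mul, comp2, Finset.mul_sum]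
  rw [Finset.sum_comm]
  exact Finset.sum_congr rfl fun i _ => Finset.sum_congr rfl fun j _ => by ring

/-- The coordinate vector fields span the tangent spaces. -/
lemma exists_eq_sum_coordVec (he : e ∈ Charts M) (hy : y ∈ e.target)
    (w : TangentSpace (𝓡 4) (e.symm y)) : ∃ a : Fin 4 → ℝ, w = ∑ i, a i • coordVec e i y := by
  have hmd : e.MDifferentiable (𝓡 4) (𝓡 4) :=
    ⟨(contMDiffOn_of_mem_maximalAtlas he).mdifferentiableOn (by simp),
      (contMDiffOn_symm_of_mem_maximalAtlas he).mdifferentiableOn (by simp)⟩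
  obtain ⟨z, hz⟩ : ∃ z : E4, mfderiv (𝓡 4) (𝓡 4) e.symm y z = w :=
    hmd.symm.mfderiv_surjective (x := y) hy w
  have hsum : z = ∑ i, z i • basisVec i := by
    have := (EuclideanSpace.basisFun (Fin 4) ℝ).sum_repr z
    simpa [basisVec] using this.symm
  refine ⟨fun i => z i, ?_⟩
  rw [← hz]
  conv_lhs => rw [hsum]
  exact (map_sum _ _ _).trans (Finset.sum_congr rfl fun i _ => map_smul _ _ _)

lemma eq_zero_of_comp2_eq_zero {t : TensorField2 M} (he : e ∈ Charts M) {x : M}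
    (hx : x ∈ e.source) (h : ∀ i j, comp2 t e i j (e x) = 0) : t x = 0 := by
  have key : t (e.symm (e x)) = 0 := by
    ext v w
    obtain ⟨a, rfl⟩ := exists_eq_sum_coordVec he (e.map_source hx) v
    obtain ⟨b, rfl⟩ := exists_eq_sum_coordVec he (e.map_source hx) w
    rw [apply_sum_coordVec]
    simp [h]
  have aux : ∀ z, z = x → t z = 0 → t x = 0 := by rintro z rfl h; exact h
  exact aux _ (e.left_inv hx) key

lemma IsLorentzMetricOn.isMetricOn_comp2 {g : TensorField2 M} (hg : IsLorentzMetricOn g U)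
    (hU : IsOpen U) (he : e ∈ Charts M) : IsMetricOn (comp2 g e) (region e U) where
  isOpen := isOpen_region hU
  smooth := hg.smooth e he
  symm y hy i j := hg.symm _ hy.2 _ _
  det_ne_zero y hy := by
    obtain ⟨b, hb⟩ := hg.signature _ hy.2
    choose a ha using fun i => exists_eq_sum_coordVec he hy.1 (b i)
    -- the Gram matrix of the orthonormal frame `b` is `B G Bᵀ`, `B` being its coordinates
    set η : Matrix (Fin 4) (Fin 4) ℝ := Matrix.diagonal fun i => if i = 0 then 1 else -1 with hη
    have hprod : Matrix.of a * (Matrix.of fun i j => comp2 g e i j y) * (Matrix.of a).transpose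
        = η := by
      ext i j
      have h1 := hb i j
      rw [ha i, ha j, apply_sum_coordVec] at h1
      rw [hη, Matrix.diagonal_apply, ← h1]
      simp only [Matrix.mul_apply, Matrix.of_apply, Matrix.transpose_apply, Finset.sum_mul]
      rw [Finset.sum_comm]
      exact Finset.sum_congr rfl fun k _ => Finset.sum_congr rfl fun l _ => by ring
    intro h0
    have hdet := congrArg Matrix.det hprod
    rw [Matrix.det_mul, Matrix.det_mul, h0, hη, Matrix.det_diagonal] at hdet
    simp [Fin.prod_univ_four] at hdet

end Coordinates

/-! ### Trace-free matter -/

section Matter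

variable {M : Type*} [TopologicalSpace M] [ChartedSpace E4 M]

lemma fieldStrength_antisymm {N : ℕ} {c : Fin N → Fin N → Fin N → ℝ} (hc : IsStructureConstants c)
    (A : Fin N → Comp1) (α : Fin N) (i j : Fin 4) (y : E4) :
    fieldStrength c A α i j y = - fieldStrength c A α j i y := by
  have h : ∑ β, ∑ γ, c α β γ * A β i y * A γ j y = - ∑ β, ∑ γ, c α β γ * A β j y * A γ i y := by
    rw [Finset.sum_comm]
    simp_rw [← Finset.sum_neg_distrib]
    exact Finset.sum_congr rfl fun β _ => Finset.sum_congr rfl fun γ _ => by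
      rw [hc.antisymm₂ α γ β]; ring
  unfold fieldStrength
  rw [h]; ring

lemma trace_yangMillsEMT {N : ℕ} {g : Comp2} {U : Set E4} (hg : IsMetricOn g U) {y : E4}
    (hy : y ∈ U) {F : Fin N → Comp2} (hF : ∀ α i j, F α i j y = - F α j i y) :
    trace g (yangMillsEMT g F) y = 0 := by
  set S : Fin N → ℝ := fun α =>
    ∑ k, ∑ l, ∑ m, ∑ n, ginv g k m y * ginv g l n y * F α k l y * F α m n y with hS
  have h1 : ∀ α, ∑ i, ∑ j, ginv g i j y * ∑ l, ∑ m, ginv g l m y * F α i l y * F α m j y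
      = - S α := by
    intro α
    rw [hS]
    simp only [Finset.mul_sum, ← Finset.sum_neg_distrib]
    refine Finset.sum_congr rfl fun i _ => ?_
    rw [Finset.sum_comm]
    refine Finset.sum_congr rfl fun l _ => Finset.sum_congr rfl fun j _ =>
      Finset.sum_congr rfl fun m _ => ?_
    rw [hF α m j]; ring
  have h2 : trace g (yangMillsEMT g F) y =
      ∑ α, (∑ i, ∑ j, ginv g i j y * (∑ l, ∑ m, ginv g l m y * F α i l y * F α m j y)
        + (1 / 4) * S α * trace g g y) := by
    have e : ∀ i j, ginv g i j y * yangMillsEMT g F i j y =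
        ∑ α, (ginv g i j y * (∑ l, ∑ m, ginv g l m y * F α i l y * F α m j y)
          + (1 / 4) * S α * (ginv g i j y * g i j y)) := by
      intro i j
      unfold yangMillsEMT
      rw [Finset.mul_sum]
      exact Finset.sum_congr rfl fun α _ => by rw [hS]; ring
    unfold trace
    simp only [e]
    refine ((Finset.sum_congr rfl fun i _ => Finset.sum_comm).trans Finset.sum_comm).trans
      (Finset.sum_congr rfl fun α _ => ?_)
    simp only [Finset.sum_add_distrib, ← Finset.mul_sum]
  rw [h2]
  simp only [h1, trace_self hg hy]
  exact Finset.sum_eq_zero fun α _ => by ring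

variable {U : Set M} {g T Tm : TensorField2 M} {e : OpenPartialHomeomorph M E4} {y : E4}

lemma IsYangMillsTensor.trace_eq_zero {N : ℕ} {c : Fin N → Fin N → Fin N → ℝ}
    (hT : IsYangMillsTensor c U g T) (hc : IsStructureConstants c) (he : e ∈ Charts M)
    (hg : IsMetricOn (comp2 g e) (region e U)) (hy : y ∈ region e U) :
    trace (comp2 g e) (comp2 T e) y = 0 := by
  obtain ⟨V, A, hV, hyV, hVU, hA, h⟩ := hT _ hy.2
  have h1 := (h e he y ⟨hy.1, hyV⟩).2
  rw [trace_congr (fun _ _ => rfl) h1]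
  exact trace_yangMillsEMT hg hy fun α i j => fieldStrength_antisymm hc _ α i j y

lemma IsRadiationFluidTensor.trace_eq_zero (hT : IsRadiationFluidTensor U g T)
    (he : e ∈ Charts M) (hg : IsMetricOn (comp2 g e) (region e U)) (hy : y ∈ region e U) :
    trace (comp2 g e) (comp2 T e) y = 0 := by
  obtain ⟨ρ, u, -, -, -, hTu, h⟩ := hT
  have h1 := (h e he y hy).1
  have h2 := trace_self hg hy
  have e1 : ∀ i j, ginv (comp2 g e) i j y * comp2 T e i j y =
      4 / 3 * ρ (e.symm y) * (ginv (comp2 g e) i j y * comp1 u e i y * comp1 u e j y)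
      - 1 / 3 * ρ (e.symm y) * (ginv (comp2 g e) i j y * comp2 g e i j y) := by
    intro i j
    have h3 : comp2 T e i j y = 4 / 3 * ρ (e.symm y) * comp1 u e i y * comp1 u e j y
        - 1 / 3 * ρ (e.symm y) * comp2 g e i j y := hTu _ hy.2 _ _
    rw [h3]; ring
  unfold trace at h2 ⊢
  simp only [e1, Finset.sum_sub_distrib, ← Finset.mul_sum]
  rw [h1, h2]; ring

lemma IsYangMillsRadiationMatter.trace_eq_zero {N : ℕ} {c : Fin N → Fin N → Fin N → ℝ}
    (hT : IsYangMillsRadiationMatter c U g Tm) (he : e ∈ Charts M)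
    (hg : IsMetricOn (comp2 g e) (region e U)) (hy : y ∈ region e U) :
    trace (comp2 g e) (comp2 Tm e) y = 0 := by
  obtain ⟨hc, s₁, s₂, T₁, T₂, -, -, h₁, h₂, h⟩ := hT
  have e1 : ∀ i j, comp2 Tm e i j y = s₁ * comp2 T₁ e i j y + s₂ * comp2 T₂ e i j y := by
    intro i j
    unfold comp2
    rw [h _ hy.2]; rfl
  rw [trace_congr (fun _ _ => rfl) (t := fun i j z => s₁ * comp2 T₁ e i j z + s₂ * comp2 T₂ e i j z)
      e1,
    trace_add (fun i j z => s₁ * comp2 T₁ e i j z) fun i j z => s₂ * comp2 T₂ e i j z,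
    trace_mul (fun _ => s₁), trace_mul (fun _ => s₂), h₁.trace_eq_zero hc he hg hy,
    h₂.trace_eq_zero he hg hy]
  simp

end Matter

/-! ### Unbounded curvature where the conformal factor vanishes -/

section Size

variable {M : Type*} [TopologicalSpace M] {e : OpenPartialHomeomorph M E4}

lemma abs_le_size (t : Comp2) (x : M) (i j : Fin 4) : |t i j (e x)| ≤ size t e x :=
  (Finset.single_le_sum (f := fun j => |t i j (e x)|) (fun _ _ => abs_nonneg _)
    (Finset.mem_univ j)).trans
    (Finset.single_le_sum (f := fun i => ∑ j, |t i j (e x)|)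
      (fun _ _ => Finset.sum_nonneg fun _ _ => abs_nonneg _) (Finset.mem_univ i))

end Size

section Unbounded

variable {M : Type*} [TopologicalSpace M] [ChartedSpace E4 M]
  {g g' : TensorField2 M} {U : Set M} {Ξ : M → ℝ} {r : ℝ} {p : M}
  {e : OpenPartialHomeomorph M E4}

lemma comp2_eventuallyEq_rescale (hU : IsOpen U) (hconf : ∀ x ∈ U, g' x = Ξ x ^ 2 • g x) {y : E4}
    (hy : y ∈ region e U) (i j : Fin 4) :
    comp2 g' e i j =ᶠ[𝓝 y] rescale (comp0 Ξ e) (comp2 g e) i j := by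
  refine ((isOpen_region hU).eventually_mem hy).mono fun z hz => ?_
  unfold comp2 rescale comp0
  rw [hconf _ hz.2]; rfl

/-- In a coordinate ball around a point where the conformal factor vanishes, the conformal factor
does not tend to zero along a curve with bounded curvature. -/
lemma exists_ball_not_tendsto (hg : IsLorentzMetricOn g univ) (hU : IsOpen U)
    (hΞ : ContMDiffOn (𝓡 4) 𝓘(ℝ, ℝ) ∞ Ξ U) (hΞ0 : ∀ x ∈ U, Ξ x ≠ 0)
    (hconf : ∀ x ∈ U, g' x = Ξ x ^ 2 • g x) (he : e ∈ Charts M)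
    (hr : ∀ y ∈ region e U, scalarCurv (comp2 g' e) y = r)
    (hc : ContinuousWithinAt Ξ U p) (hz : Ξ p = 0) (hp : p ∈ e.source) :
    ∃ ρ > 0, Metric.closedBall (e p) ρ ⊆ e.target ∧ ∀ (a b D C : ℝ) (x x' : ℝ → E4), a < b →
      (∀ s ∈ Ico a b, HasDerivAt x (x' s) s) → (∀ s ∈ Ico a b, x s ∈ region e U) →
      (∀ s ∈ Ico a b, x s ∈ Metric.closedBall (e p) ρ) → (∀ s ∈ Ico a b, ‖x' s‖ ≤ D) →
      (∀ s ∈ Ico a b, ∀ i j, |ricci (comp2 g' e) i j (x s)| ≤ C) →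
      ¬ Tendsto (fun s => Ξ (e.symm (x s))) (𝓝[<] b) (𝓝 0) := by
  have hsmall : ∀ᶠ y in 𝓝 (e p), y ∈ e.target ∧ (e.symm y ∈ U → |Ξ (e.symm y)| ≤ 1) := by
    refine (e.open_target.eventually_mem (e.map_source hp)).and ?_
    have h1 : ∀ᶠ x in 𝓝 p, x ∈ U → |Ξ x| ≤ 1 := by
      have h2 : Tendsto (fun x => |Ξ x|) (𝓝[U] p) (𝓝 0) := by
        have := hc.tendsto.abs
        rwa [hz, abs_zero] at this
      exact eventually_nhdsWithin_iff.1 (h2.eventually_le_const zero_lt_one)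
    have h3 : Tendsto e.symm (𝓝 (e p)) (𝓝 p) := by
      have := (e.continuousAt_symm (e.map_source hp)).tendsto
      rwa [e.left_inv hp] at this
    exact h3.eventually h1
  obtain ⟨ρ, hρ, hball⟩ := Metric.nhds_basis_closedBall.eventually_iff.1 hsmall
  refine ⟨ρ, hρ, fun y hy => (hball hy).1, fun a b D C x x' hab hx hxU hxK hx' hC => ?_⟩
  have hW : IsMetricOn (comp2 g e) e.target := by
    have := hg.isMetricOn_comp2 isOpen_univ he
    rwa [region, preimage_univ, inter_univ] at this
  have hcongr : ∀ y ∈ region e U, ∀ i j, comp2 g' e i j =ᶠ[𝓝 y]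
      rescale (comp0 Ξ e) (comp2 g e) i j :=
    fun y hy i j => comp2_eventuallyEq_rescale hU hconf hy i j
  refine not_ricci_bounded_along_curve (f := comp0 Ξ e) hW (isCompact_closedBall (e p) ρ)
    (fun y hy => (hball hy).1) (isOpen_region hU) inter_subset_left (contDiffOn_comp0 hΞ he)
    (fun y hy => hΞ0 _ hy.2) (r := r) (fun y hy => ?_) hab hx hxU hxK
    (fun s hs k => (PiLp.norm_apply_le (x' s) k).trans (hx' s hs))
    (fun s hs => (hball (hxK s hs)).2 (hxU s hs).2) (C := C) fun s hs i j => ?_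
  · rw [← hr y hy]
    exact (trace_congr (fun i j => (hcongr y hy i j).eq_of_nhds) (ricci_congr (hcongr y hy))).symm
  · rw [← ricci_congr (hcongr _ (hxU s hs))]
    exact hC s hs i j

/-- A metric of constant scalar curvature that is conformal to a regular one has unbounded Ricci
tensor near each boundary point at which the conformal factor vanishes: a coordinate segment
towards the point is followed until it leaves `U`. -/
lemma ricciUnboundedNear_of_scalarCurv (hg : IsLorentzMetricOn g univ) (hU : IsOpen U)
    (hΞ : ContMDiffOn (𝓡 4) 𝓘(ℝ, ℝ) ∞ Ξ U) (hΞ0 : ∀ x ∈ U, Ξ x ≠ 0)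
    (hconf : ∀ x ∈ U, g' x = Ξ x ^ 2 • g x)
    (hr : ∀ e ∈ Charts M, ∀ y ∈ region e U, scalarCurv (comp2 g' e) y = r)
    (hc : ContinuousOn Ξ (closure U)) (hz : ∀ x ∈ closure U \ U, Ξ x = 0)
    (hp : p ∈ closure U \ U) : RicciUnboundedNear g' U p := by
  intro e he hpe C
  by_contra hcon
  rw [not_frequently] at hcon
  simp only [not_lt] at hcon
  obtain ⟨ρ, hρ, hballt, hcurve⟩ := exists_ball_not_tendsto hg hU hΞ hΞ0 hconf he (hr e he)
    ((hc p hp.1).mono subset_closure) (hz p hp) hpe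
  -- a ball in which the Ricci tensor is bounded
  have hb : ∀ᶠ y in 𝓝 (e p), e.symm y ∈ U →
      size (ricci (comp2 g' e)) e (e.symm y) ≤ C := by
    have h3 : Tendsto e.symm (𝓝 (e p)) (𝓝 p) := by
      have := (e.continuousAt_symm (e.map_source hpe)).tendsto
      rwa [e.left_inv hpe] at this
    exact h3.eventually (eventually_nhdsWithin_iff.1 hcon)
  obtain ⟨δ, hδ, hball⟩ := Metric.nhds_basis_closedBall.eventually_iff.1 hb
  set d := min ρ δ with hd
  have hd0 : 0 < d := lt_min hρ hδ
  -- a point of `U` in this ball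
  have hnear : ∀ᶠ x in 𝓝 p, x ∈ e.source ∧ e x ∈ Metric.closedBall (e p) d :=
    (e.open_source.eventually_mem hpe).and
      ((e.continuousAt hpe).eventually (Metric.closedBall_mem_nhds _ hd0))
  obtain ⟨x₀, ⟨hx₀s, hx₀b⟩, hx₀U⟩ := mem_closure_iff_nhds.1 hp.1 _ hnear
  set v : E4 := e p - e x₀ with hv
  set x : ℝ → E4 := fun s => e x₀ + s • v with hx
  have hxc : Continuous x := by fun_prop
  have hx0 : x 0 = e x₀ := by simp [hx]
  have hx1 : x 1 = e p := by simp [hx, hv]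
  have hxd : ∀ s ∈ Icc (0 : ℝ) 1, x s ∈ Metric.closedBall (e p) d := by
    intro s hs
    refine (convex_closedBall (e p) d).add_smul_sub_mem hx₀b (Metric.mem_closedBall_self hd0.le) hs
  have hxt : ∀ s ∈ Icc (0 : ℝ) 1, x s ∈ e.target := fun s hs =>
    hballt (Metric.closedBall_subset_closedBall (min_le_left _ _) (hxd s hs))
  -- the first exit time
  set A : Set ℝ := Icc 0 1 ∩ (x ⁻¹' region e U)ᶜ with hA
  have hAc : IsCompact A :=
    isCompact_Icc.inter_right ((isOpen_region hU).preimage hxc).isClosed_compl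
  have hA1 : (1 : ℝ) ∈ A := by
    refine ⟨⟨zero_le_one, le_rfl⟩, fun h => hp.2 ?_⟩
    have := h.2
    rwa [mem_preimage, hx1, e.left_inv hpe] at this
  have hbA := hAc.sInf_mem ⟨1, hA1⟩
  set b := sInf A with hbdef
  have hlt : ∀ s ∈ Ico 0 b, x s ∈ region e U := by
    intro s hs
    by_contra h
    exact absurd (csInf_le hAc.bddBelow (show s ∈ A from
      ⟨⟨hs.1, hs.2.le.trans hbA.1.2⟩, h⟩)) (not_le.2 hs.2)
  have hb0 : 0 < b := by
    refine lt_of_le_of_ne hbA.1.1 fun h => hbA.2 ?_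
    rw [← h, mem_preimage, hx0]
    exact mem_region hx₀s hx₀U
  have hsub : ∀ s ∈ Ico 0 b, s ∈ Icc (0 : ℝ) 1 := fun s hs =>
    ⟨hs.1, hs.2.le.trans hbA.1.2⟩
  have hev : ∀ᶠ s in 𝓝[<] b, s ∈ Ico 0 b := Ico_mem_nhdsLT hb0
  have htend : Tendsto (fun s => e.symm (x s)) (𝓝[<] b) (𝓝[U] (e.symm (x b))) := by
    refine tendsto_nhdsWithin_iff.2 ⟨?_, hev.mono fun s hs => (hlt s hs).2⟩
    exact ((e.continuousAt_symm (hxt b hbA.1)).tendsto.comp hxc.continuousAt.tendsto).mono_left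
      nhdsWithin_le_nhds
  have hcl : e.symm (x b) ∈ closure U :=
    mem_closure_of_tendsto (tendsto_nhdsWithin_iff.1 htend).1 (tendsto_nhdsWithin_iff.1 htend).2
  have hnot : e.symm (x b) ∉ U := fun h => hbA.2 ⟨hxt b hbA.1, h⟩
  refine hcurve 0 b ‖v‖ C x (fun _ => v) hb0 (fun s _ => ?_) hlt
    (fun s hs => Metric.closedBall_subset_closedBall (min_le_left _ _) (hxd s (hsub s hs)))
    (fun _ _ => le_rfl) (fun s hs i j => ?_) ?_
  · have h : HasDerivAt x ((1 : ℝ) • v) s := ((hasDerivAt_id s).smul_const v).const_add (e x₀)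
    rwa [one_smul] at h
  · have h1 := hball (Metric.closedBall_subset_closedBall (min_le_right _ _) (hxd s (hsub s hs)))
      (hlt s hs).2
    have h2 := abs_le_size (e := e) (ricci (comp2 g' e)) (e.symm (x s)) i j
    rw [e.right_inv (hxt s (hsub s hs))] at h2
    exact h2.trans h1
  · have := (((hc _ hcl).mono subset_closure).tendsto).comp htend
    rwa [hz _ ⟨hcl, hnot⟩] at this

/-- A metric of constant scalar curvature that is conformal to a regular one has unbounded Ricci
tensor along each curve to a boundary point at which the conformal factor vanishes. -/
lemma ricciUnboundedAlongCurves_of_scalarCurv (hg : IsLorentzMetricOn g univ) (hU : IsOpen U)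
    (hΞ : ContMDiffOn (𝓡 4) 𝓘(ℝ, ℝ) ∞ Ξ U) (hΞ0 : ∀ x ∈ U, Ξ x ≠ 0)
    (hconf : ∀ x ∈ U, g' x = Ξ x ^ 2 • g x)
    (hr : ∀ e ∈ Charts M, ∀ y ∈ region e U, scalarCurv (comp2 g' e) y = r)
    (hc : ContinuousWithinAt Ξ U p) (hz : Ξ p = 0) : RicciUnboundedAlongCurves g' U p := by
  intro e he hpe γ hγ hγU hγ1 C
  by_contra hcon
  rw [not_frequently] at hcon
  simp only [not_lt] at hcon
  obtain ⟨ρ, hρ, -, hcurve⟩ := exists_ball_not_tendsto hg hU hΞ hΞ0 hconf he (hr e he) hc hz hpe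
  have hγc : Tendsto γ (𝓝[Icc 0 1] 1) (𝓝 p) := by
    have := (hγ.continuousOn 1 ⟨zero_le_one, le_rfl⟩).tendsto
    rwa [hγ1] at this
  have hnear : ∀ᶠ x in 𝓝 p, x ∈ e.source ∧ e x ∈ Metric.closedBall (e p) ρ :=
    (e.open_source.eventually_mem hpe).and
      ((e.continuousAt hpe).eventually (Metric.closedBall_mem_nhds _ hρ))
  have hle : 𝓝[<] (1 : ℝ) ≤ 𝓝[Icc 0 1] 1 := by
    refine nhdsWithin_le_iff.2 (mem_of_superset (Ico_mem_nhdsLT zero_lt_one) Ico_subset_Icc_self)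
  have hall : ∀ᶠ s in 𝓝[<] (1 : ℝ), (γ s ∈ e.source ∧ e (γ s) ∈ Metric.closedBall (e p) ρ) ∧
      size (ricci (comp2 g' e)) e (γ s) ≤ C :=
    ((hγc.mono_left hle).eventually hnear).and hcon
  obtain ⟨s₀, hs₀, hs₀1⟩ := mem_nhdsLT_iff_exists_Ico_subset.1 hall
  set a₀ := max s₀ 0 with ha₀
  have ha₀1 : a₀ < 1 := max_lt hs₀ zero_lt_one
  have ha₀0 : 0 ≤ a₀ := le_max_right _ _
  have hgood : ∀ s ∈ Ico a₀ 1, (γ s ∈ e.source ∧ e (γ s) ∈ Metric.closedBall (e p) ρ) ∧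
      size (ricci (comp2 g' e)) e (γ s) ≤ C := fun s hs =>
    hs₀1 ⟨(le_max_left _ _).trans hs.1, hs.2⟩
  have hsrc : ∀ s ∈ Icc a₀ 1, γ s ∈ e.source := by
    intro s hs
    rcases eq_or_lt_of_le hs.2 with h | h
    · rw [h, hγ1]; exact hpe
    · exact (hgood s ⟨hs.1, h⟩).1.1
  -- the coordinate expression of the curve is `C¹` up to the end point
  have hC1 : ContDiffOn ℝ 1 (e ∘ γ) (Icc a₀ 1) := by
    have h1 : ContMDiffOn 𝓘(ℝ, ℝ) (𝓡 4) 1 (e ∘ γ) (Icc a₀ 1) :=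
      ((contMDiffOn_of_mem_maximalAtlas he).of_le (by simp)).comp
        (hγ.mono (Icc_subset_Icc_left ha₀0)) hsrc
    exact contMDiffOn_iff_contDiffOn.1 h1
  have hder := hC1.continuousOn_derivWithin (uniqueDiffOn_Icc ha₀1) le_rfl
  obtain ⟨D, hD⟩ := isCompact_Icc.exists_bound_of_continuousOn hder
  set a := (a₀ + 1) / 2 with ha
  have ha1 : a < 1 := by rw [ha]; linarith
  have haa : a₀ < a := by rw [ha]; linarith
  have hIco : ∀ s ∈ Ico a 1, s ∈ Ico a₀ 1 := fun s hs => ⟨haa.le.trans hs.1, hs.2⟩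
  refine hcurve a 1 D C (e ∘ γ) (derivWithin (e ∘ γ) (Icc a₀ 1)) ha1 (fun s hs => ?_)
    (fun s hs => mem_region (hgood s (hIco s hs)).1.1
      (hγU s ⟨ha₀0.trans (hIco s hs).1, hs.2⟩))
    (fun s hs => (hgood s (hIco s hs)).1.2) (fun s hs => hD s ⟨(hIco s hs).1, hs.2.le⟩)
    (fun s hs i j => (abs_le_size (e := e) (ricci (comp2 g' e)) (γ s) i j).trans
      (hgood s (hIco s hs)).2) ?_
  · exact ((hC1.differentiableOn one_ne_zero) s
      ⟨(hIco s hs).1, hs.2.le⟩).hasDerivWithinAt.hasDerivAt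
      (Icc_mem_nhds (haa.trans_le hs.1) hs.2)
  · have h1 : Tendsto γ (𝓝[<] 1) (𝓝[U] p) :=
      tendsto_nhdsWithin_iff.2 ⟨hγc.mono_left hle,
        Filter.mem_of_superset (Ico_mem_nhdsLT zero_lt_one) hγU⟩
    have h2 := hc.tendsto.comp h1
    rw [hz] at h2
    refine h2.congr' ?_
    filter_upwards [Ico_mem_nhdsLT ha1] with s hs
    simp [e.left_inv (hgood s (hIco s hs)).1.1]

end Unbounded

/-! ### Tensors that tend to infinity -/

section Divergence

variable {M : Type*} [TopologicalSpace M]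

/-- A tensor of the form `± ψ⁻² A + B`, where `ψ` tends to zero, `A` has a nonzero limit and `B` a
finite one, tends to infinity. -/
lemma tendsto_size_atTop {t : Comp2} {e : OpenPartialHomeomorph M E4} {l : Filter M} {ψ : M → ℝ}
    {A B : Fin 4 → Fin 4 → M → ℝ} {S S' : Fin 4 → Fin 4 → ℝ} {ε : ℝ} (hε : ε = 1 ∨ ε = -1)
    (hS : S ≠ 0) (hA : ∀ i j, Tendsto (A i j) l (𝓝 (S i j)))
    (hB : ∀ i j, Tendsto (B i j) l (𝓝 (S' i j)))
    (hψ : Tendsto ψ l (𝓝 0)) (hψ0 : ∀ᶠ x in l, ψ x ≠ 0)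
    (ht : ∀ᶠ x in l, ∀ i j, t i j (e x) = ε * (ψ x ^ 2)⁻¹ * A i j x + B i j x) :
    Tendsto (size t e) l atTop := by
  obtain ⟨i, j, hij⟩ : ∃ i j, S i j ≠ 0 := by
    by_contra! h
    exact hS (by ext i j; exact h i j)
  have h1 : Tendsto (fun x => (ψ x ^ 2)⁻¹) l atTop := by
    refine tendsto_inv_nhdsGT_zero.comp (tendsto_nhdsWithin_iff.2 ⟨by simpa using hψ.pow 2, ?_⟩)
    exact hψ0.mono fun x hx => by
      have : 0 < ψ x ^ 2 := by positivity
      exact this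
  have h2 : Tendsto (fun x => (ψ x ^ 2)⁻¹ * |A i j x|) l atTop :=
    h1.atTop_mul_pos (abs_pos.2 hij) (hA i j).abs
  have h3 : Tendsto (fun x => (ψ x ^ 2)⁻¹ * |A i j x| + -|B i j x|) l atTop :=
    h2.atTop_add (hB i j).abs.neg
  refine tendsto_atTop_mono' l ?_ h3
  filter_upwards [ht] with x hx
  refine le_trans ?_ (abs_le_size (e := e) t x i j)
  have hε1 : |ε| = 1 := by rcases hε with rfl | rfl <;> simp
  have h4 : |ε * (ψ x ^ 2)⁻¹ * A i j x| = (ψ x ^ 2)⁻¹ * |A i j x| := by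
    rw [abs_mul, abs_mul, hε1, one_mul, abs_of_nonneg (inv_nonneg.2 (sq_nonneg _))]
  have h5 := abs_sub_abs_le_abs_sub (ε * (ψ x ^ 2)⁻¹ * A i j x) (-(B i j x))
  rw [abs_neg, sub_neg_eq_add, h4] at h5
  rw [hx i j]
  linarith

end Divergence

/-! ### The dual spacetime of a weakly asymptotically flat spacetime -/

section DualRegion

lemma dualRegion_subset {M : Type*} {U : Set M} {φ : M → ℝ} : dualRegion U φ ⊆ U :=
  fun _ hx => hx.1

variable {M : Type*} [TopologicalSpace M] {U : Set M} {φ : M → ℝ}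

lemma isOpen_dualRegion (hU : IsOpen U) (hφ : ContinuousOn φ U) : IsOpen (dualRegion U φ) :=
  hφ.isOpen_inter_preimage hU isOpen_compl_singleton

lemma subset_closure_dualRegion
    (hφ : ∀ V : Set M, IsOpen V → V.Nonempty → V ⊆ U → ∃ x ∈ V, φ x ≠ 0) (hU : IsOpen U) :
    closure U ⊆ closure (dualRegion U φ) := by
  intro x hx
  refine mem_closure_iff.2 fun O hO hxO => ?_
  obtain ⟨z, hz, hz0⟩ := hφ (O ∩ U) (hO.inter hU) (mem_closure_iff.1 hx O hO hxO)
    inter_subset_right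
  exact ⟨z, hz.1, hz.2, hz0⟩

end DualRegion

section Dual

variable {M : Type*} [TopologicalSpace M] [ChartedSpace E4 M]
  {ghat Tm : TensorField2 M} {U : Set M} {φ : M → ℝ} {ε lam mu : ℝ}
  {e : OpenPartialHomeomorph M E4} {y : E4}

lemma IsLorentzMetricOn.dualMetric (hg : IsLorentzMetricOn ghat U)
    (hφ : ContMDiffOn (𝓡 4) 𝓘(ℝ, ℝ) ∞ φ U) :
    IsLorentzMetricOn (dualMetric φ ghat) (dualRegion U φ) where
  smooth e he i j :=
    (((contDiffOn_comp0 hφ he).pow 2).mul (hg.smooth e he i j)).mono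
      (region_mono dualRegion_subset)
  symm x hx v w := by
    change φ x ^ 2 * ghat x v w = φ x ^ 2 * ghat x w v
    rw [hg.symm x hx.1]
  signature x hx := by
    obtain ⟨b, hb⟩ := hg.signature x hx.1
    refine ⟨fun i => (φ x)⁻¹ • b i, fun i j => ?_⟩
    have h : CCC.dualMetric φ ghat x ((φ x)⁻¹ • b i) ((φ x)⁻¹ • b j) =
        φ x ^ 2 * ((φ x)⁻¹ * ((φ x)⁻¹ * ghat x (b i) (b j))) := by
      simp [CCC.dualMetric]
      ring
    have h0 : φ x ≠ 0 := hx.2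
    rw [h, hb]
    field_simp

/-- The metric components on the coordinate image of the dual spacetime. -/
lemma IsConformalScalarSolution.isMetricOn_dualRegion
    (hsol : IsConformalScalarSolution U ghat φ ε lam mu Tm) (he : e ∈ Charts M) :
    IsMetricOn (comp2 ghat e) (region e (dualRegion U φ)) :=
  (hsol.metric.isMetricOn_comp2 hsol.isOpen he).mono
    (isOpen_region (isOpen_dualRegion hsol.isOpen hsol.smooth.continuousOn))
    (region_mono dualRegion_subset)

lemma IsConformalScalarSolution.contDiffOn_dualRegion
    (hsol : IsConformalScalarSolution U ghat φ ε lam mu Tm) (he : e ∈ Charts M) :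
    ContDiffOn ℝ ∞ (comp0 φ e) (region e (dualRegion U φ)) :=
  (contDiffOn_comp0 hsol.smooth he).mono (region_mono dualRegion_subset)

lemma IsConformalScalarSolution.scalarCurv_dualMetric
    (hsol : IsConformalScalarSolution U ghat φ ε lam mu Tm) (he : e ∈ Charts M)
    (hy : y ∈ region e (dualRegion U φ)) :
    scalarCurv (comp2 (dualMetric φ ghat) e) y = 24 * mu :=
  scalarCurv_rescale_eq (hsol.isMetricOn_dualRegion he) (hsol.contDiffOn_dualRegion he)
    (fun _ hz => hz.2.2) hy (hsol.wave e he y (region_mono dualRegion_subset hy))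

lemma IsConformalScalarSolution.ricci_dualMetric
    (hsol : IsConformalScalarSolution U ghat φ ε lam mu Tm) (hε : ε = 1 ∨ ε = -1)
    (he : e ∈ Charts M) (hy : y ∈ region e (dualRegion U φ)) (i j : Fin 4) :
    ricci (comp2 (dualMetric φ ghat) e) i j y =
      ε * (comp0 φ e y ^ 2)⁻¹ * scalarEMT ε mu (comp2 ghat e) (comp0 φ e) i j y
        + 6 * mu * (comp0 φ e y ^ 2 * comp2 ghat e i j y) :=
  ricci_rescale_eq_scalarEMT (hsol.isMetricOn_dualRegion he) (hsol.contDiffOn_dualRegion he)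
    (fun _ hz => hz.2.2) hy hε (hsol.wave e he y (region_mono dualRegion_subset hy)) i j

lemma IsConformalScalarSolution.scalarEMT_dualMetric
    (hsol : IsConformalScalarSolution U ghat φ ε lam mu Tm) (he : e ∈ Charts M)
    (hTm : ∀ y ∈ region e U, trace (comp2 ghat e) (comp2 Tm e) y = 0)
    (hy : y ∈ region e (dualRegion U φ)) (i j : Fin 4) :
    scalarEMT ε lam (comp2 (dualMetric φ ghat) e) (comp0 (fun x => (φ x)⁻¹) e) i j y =
      ε * (comp0 φ e y ^ 2)⁻¹ * totalEMT ε mu ghat Tm φ e i j y := by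
  have hyU := region_mono dualRegion_subset hy
  refine scalarEMT_dual (hsol.isMetricOn_dualRegion he) (hsol.contDiffOn_dualRegion he)
    (fun _ hz => hz.2.2) hy ε ?_ (hsol.einstein_eq e he y hyU) i j
  have h1 : trace (comp2 ghat e) (totalEMT ε mu ghat Tm φ e) y = _ :=
    trace_add (scalarEMT ε mu (comp2 ghat e) (comp0 φ e)) (comp2 Tm e)
  rw [h1, trace_scalarEMT (hsol.isMetricOn_dualRegion he) hy ε (hsol.wave e he y hyU),
    hTm y hyU, add_zero]

lemma tendsto_comp2_of_continuousOn {S : Set M} {t : TensorField2 M} (ht : Continuous2On t S)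
    {V : Set M} (hV : V ⊆ S) (he : e ∈ Charts M) {p : M} (hp : p ∈ S) (hpe : p ∈ e.source)
    (i j : Fin 4) :
    Tendsto (fun x => comp2 t e i j (e x)) (𝓝[V] p) (𝓝 (comp2 t e i j (e p))) := by
  refine (ht e he i j (e p) (mem_region hpe hp)).tendsto.comp (tendsto_nhdsWithin_iff.2
    ⟨(e.continuousAt hpe).tendsto.mono_left nhdsWithin_le_nhds, ?_⟩)
  filter_upwards [self_mem_nhdsWithin, nhdsWithin_le_nhds (e.open_source.mem_nhds hpe)]
    with x hx hxe
  exact mem_region hxe (hV hx)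

end Dual

end CCC

end

theorem mainTheorem5
    {M : Type*} [TopologicalSpace M] [T2Space M] [ChartedSpace CCC.E4 M]
    [IsManifold (𝓡 4) ∞ M]
    (g ghat T Tm : CCC.TensorField2 M) (Mhat Sig : Set M) (θ φ Φ : M → ℝ)
    (ε lam mu : ℝ) (hε : ε = 1 ∨ ε = -1)
    {N : ℕ} (c : Fin N → Fin N → Fin N → ℝ)
    -- the physical spacetime, a conformal scalar field coupled to trace-free matter
    (hsol : CCC.IsConformalScalarSolution Mhat ghat φ ε lam mu Tm)
    (hmatter : CCC.IsTraceFreeMatter Mhat ghat Tm ∨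
      CCC.IsYangMillsRadiationMatter c Mhat ghat Tm)
    -- the scalar field does not vanish identically on any nonempty open set
    (hφ : ∀ V : Set M, IsOpen V → V.Nonempty → V ⊆ Mhat → ∃ x ∈ V, φ x ≠ 0)
    -- the conformal boundary is a spacelike hypersurface
    (hwaf : CCC.IsWeaklyAsymptoticallyFlat g Mhat ghat θ)
    (hSig : Sig = frontier Mhat) (hspace : CCC.IsSpacelikeHypersurface g Sig)
    -- the unphysical scalar field vanishes on the conformal boundary
    (hΦ : ∀ x ∈ Mhat, Φ x = φ x / θ x) (hΦc : ContinuousOn Φ (Mhat ∪ Sig))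
    (hΦ0 : ∀ x ∈ Sig, Φ x = 0)
    -- the rescaled total energy-momentum tensor is finite and nonzero on the conformal boundary
    (hT : ∀ e ∈ CCC.Charts M, ∀ y ∈ CCC.region e Mhat, ∀ i j,
      CCC.comp2 T e i j y =
        (CCC.comp0 θ e y ^ 2)⁻¹ * CCC.totalEMT ε mu ghat Tm φ e i j y)
    (hTc : CCC.Continuous2On T (Mhat ∪ Sig)) (hT0 : ∀ x ∈ Sig, T x ≠ 0) :
    -- the conformal boundary is an isotropic singularity of the dual spacetime
    CCC.IsIsotropicSingularity g (CCC.dualRegion Mhat φ) (CCC.dualMetric φ ghat) Sig ∧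
    -- without further matter the Ricci tensor of the dual metric tends to infinity
    ((∀ x ∈ Mhat, Tm x = 0) → ∀ p ∈ Sig,
      CCC.RicciDivergesAt (CCC.dualMetric φ ghat) (CCC.dualRegion Mhat φ) p) ∧
    -- with matter, so it does where the scalar part of the rescaled tensor is finite and nonzero
    (∀ p ∈ Sig, ∀ e ∈ CCC.Charts M, p ∈ e.source →
      (∃ S : Fin 4 → Fin 4 → ℝ, S ≠ 0 ∧ ∀ i j, Tendsto (fun x => (θ x ^ 2)⁻¹ *
        CCC.scalarEMT ε mu (CCC.comp2 ghat e) (CCC.comp0 φ e) i j (e x))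
        (𝓝[Mhat] p) (𝓝 (S i j))) →
      Tendsto (CCC.size (CCC.ricci (CCC.comp2 (CCC.dualMetric φ ghat) e)) e)
        (𝓝[CCC.dualRegion Mhat φ] p) atTop) ∧
    -- the energy-momentum tensor of the dual scalar field tends to infinity
    (∀ p ∈ Sig, ∀ e ∈ CCC.Charts M, p ∈ e.source →
      Tendsto (CCC.size (CCC.scalarEMT ε lam (CCC.comp2 (CCC.dualMetric φ ghat) e)
        (CCC.comp0 (fun x => (φ x)⁻¹) e)) e) (𝓝[CCC.dualRegion Mhat φ] p) atTop) := by
  subst hSig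
  set U := CCC.dualRegion Mhat φ with hU
  have hMo : IsOpen Mhat := hsol.isOpen
  have hUM : U ⊆ Mhat := CCC.dualRegion_subset
  have hUo : IsOpen U := CCC.isOpen_dualRegion hMo hsol.smooth.continuousOn
  have hcl : closure Mhat = Mhat ∪ frontier Mhat := closure_eq_self_union_frontier Mhat
  have hUcl : closure U ⊆ Mhat ∪ frontier Mhat := hcl ▸ closure_mono hUM
  have hSU : frontier Mhat ⊆ closure U :=
    frontier_subset_closure.trans (CCC.subset_closure_dualRegion hφ hMo)
  have hdisj : Disjoint (frontier Mhat) U :=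
    (disjoint_frontier_iff_isOpen.2 hMo).mono_left le_rfl |>.mono_right hUM
  have hpU : ∀ p ∈ frontier Mhat, p ∈ closure U \ U := fun p hp =>
    ⟨hSU hp, fun h => hdisj.le_bot ⟨hp, h⟩⟩
  have hθ : ∀ x ∈ Mhat, θ x ≠ 0 := fun x hx => (hwaf.pos x hx).ne'
  have hΦs : ContMDiffOn (𝓡 4) 𝓘(ℝ, ℝ) ∞ Φ U :=
    ((hsol.smooth.div₀ hwaf.smooth.contMDiffOn hθ).congr hΦ).mono hUM
  have hΦne : ∀ x ∈ U, Φ x ≠ 0 := fun x hx => by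
    rw [hΦ x hx.1]; exact div_ne_zero hx.2 (hθ x hx.1)
  have hconf : ∀ x ∈ U, CCC.dualMetric φ ghat x = Φ x ^ 2 • g x := fun x hx => by
    have h0 := hθ x hx.1
    rw [hwaf.conformal x hx.1, hΦ x hx.1, smul_smul, CCC.dualMetric]
    congr 1
    field_simp
  have hr : ∀ e ∈ CCC.Charts M, ∀ y ∈ CCC.region e U,
      CCC.scalarCurv (CCC.comp2 (CCC.dualMetric φ ghat) e) y = 24 * mu :=
    fun e he y hy => hsol.scalarCurv_dualMetric he hy
  have hz : ∀ x ∈ closure U \ U, Φ x = 0 := by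
    rintro x ⟨hx, hxU⟩
    rcases hUcl hx with h | h
    · have : φ x = 0 := by
        by_contra h0
        exact hxU ⟨h, h0⟩
      rw [hΦ x h, this, zero_div]
    · exact hΦ0 x h
  have hΦcU : ∀ p ∈ frontier Mhat, ContinuousWithinAt Φ U p := fun p hp =>
    (hΦc p (Or.inr hp)).mono (hUM.trans subset_union_left)
  have hΦlim : ∀ p ∈ frontier Mhat, Tendsto Φ (𝓝[U] p) (𝓝 0) := fun p hp => by
    have := (hΦcU p hp).tendsto
    rwa [hΦ0 p hp] at this
  have hΦev : ∀ p, ∀ᶠ x in 𝓝[U] p, Φ x ≠ 0 := fun p =>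
    eventually_mem_nhdsWithin.mono hΦne
  have hev : ∀ (e : OpenPartialHomeomorph M CCC.E4) (p : M), p ∈ e.source →
      ∀ᶠ x in 𝓝[U] p, x ∈ e.source ∧ x ∈ U := fun e p hpe =>
    Eventually.and (nhdsWithin_le_nhds (e.open_source.mem_nhds hpe)) eventually_mem_nhdsWithin
  have hφΦ : ∀ x ∈ U, (φ x ^ 2)⁻¹ = (Φ x ^ 2)⁻¹ * (θ x ^ 2)⁻¹ := fun x hx => by
    have h0 := hθ x hx.1
    rw [hΦ x hx.1]
    field_simp
  have hTS : ∀ p ∈ frontier Mhat, ∀ e ∈ CCC.Charts M, p ∈ e.source →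
      (fun i j => CCC.comp2 T e i j (e p)) ≠ 0 := fun p hp e he hpe h =>
    hT0 p hp (CCC.eq_zero_of_comp2_eq_zero he hpe fun i j => congrFun (congrFun h i) j)
  have hTlim : ∀ p ∈ frontier Mhat, ∀ e ∈ CCC.Charts M, p ∈ e.source → ∀ i j,
      Tendsto (fun x => CCC.comp2 T e i j (e x)) (𝓝[Mhat] p) (𝓝 (CCC.comp2 T e i j (e p))) :=
    fun p hp e he hpe i j => CCC.tendsto_comp2_of_continuousOn hTc subset_union_left he
      (Or.inr hp) hpe i j
  have hglim : ∀ (p : M), ∀ e ∈ CCC.Charts M, p ∈ e.source → ∀ i j,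
      Tendsto (fun x => CCC.comp2 g e i j (e x)) (𝓝[U] p) (𝓝 (CCC.comp2 g e i j (e p))) :=
    fun p e he hpe i j => CCC.tendsto_comp2_of_continuousOn
      (fun e he i j => (hwaf.regular.smooth e he i j).continuousOn) (subset_univ _) he
      (mem_univ p) hpe i j
  have htr : ∀ e ∈ CCC.Charts M, ∀ y ∈ CCC.region e Mhat,
      CCC.trace (CCC.comp2 ghat e) (CCC.comp2 Tm e) y = 0 := fun e he y hy => by
    rcases hmatter with h | h
    · exact h.trace_eq e he y hy
    · exact h.trace_eq_zero he (hsol.metric.isMetricOn_comp2 hMo he) hy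
  -- divergence of the Ricci tensor where the scalar part of `T` is finite and nonzero
  have hscalar : ∀ p ∈ frontier Mhat, ∀ e ∈ CCC.Charts M, p ∈ e.source →
      (∃ S : Fin 4 → Fin 4 → ℝ, S ≠ 0 ∧ ∀ i j, Tendsto (fun x => (θ x ^ 2)⁻¹ *
        CCC.scalarEMT ε mu (CCC.comp2 ghat e) (CCC.comp0 φ e) i j (e x))
        (𝓝[Mhat] p) (𝓝 (S i j))) →
      Tendsto (CCC.size (CCC.ricci (CCC.comp2 (CCC.dualMetric φ ghat) e)) e)
        (𝓝[U] p) atTop := by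
    rintro p hp e he hpe ⟨S, hS, hlim⟩
    refine CCC.tendsto_size_atTop hε hS (fun i j => (hlim i j).mono_left (nhdsWithin_mono p hUM))
      (B := fun i j x => 6 * mu * (Φ x ^ 2 * CCC.comp2 g e i j (e x)))
      (fun i j => (((hΦlim p hp).pow 2).mul (hglim p e he hpe i j)).const_mul (6 * mu))
      (hΦlim p hp) (hΦev p) ?_
    filter_upwards [hev e p hpe] with x ⟨hxe, hxU⟩ i j
    have hy := CCC.mem_region hxe hxU
    have h1 : CCC.comp2 (CCC.dualMetric φ ghat) e i j (e x) =
        Φ x ^ 2 * CCC.comp2 g e i j (e x) := by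
      rw [(CCC.comp2_eventuallyEq_rescale hUo hconf hy i j).eq_of_nhds]
      simp [CCC.rescale, CCC.comp0, e.left_inv hxe]
    have h2 : CCC.comp0 φ e (e x) = φ x := by simp [CCC.comp0, e.left_inv hxe]
    have h3 : CCC.comp0 φ e (e x) ^ 2 * CCC.comp2 ghat e i j (e x) =
        Φ x ^ 2 * CCC.comp2 g e i j (e x) := h1
    rw [hsol.ricci_dualMetric hε he hy, h3, h2, hφΦ x hxU]
    ring
  refine ⟨⟨hwaf.regular, hUo, hsol.metric.dualMetric hsol.smooth, hwaf.boundary_nonempty, hspace,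
    hSU, hdisj, ⟨Φ, hΦs, hΦc.mono (union_subset_union_left _ hUM),
      fun x hx => ⟨hΦne x hx, hconf x hx⟩, hΦ0⟩, fun p hp => ⟨?_, ?_⟩⟩, ?_, hscalar, ?_⟩
  · exact CCC.ricciUnboundedNear_of_scalarCurv hwaf.regular hUo hΦs hΦne hconf hr
      (hΦc.mono hUcl) hz (hpU p hp)
  · exact CCC.ricciUnboundedAlongCurves_of_scalarCurv hwaf.regular hUo hΦs hΦne hconf hr
      (hΦcU p hp) (hΦ0 p hp)
  · -- without matter the scalar part is all of `T`
    intro hTm p hp e he hpe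
    refine hscalar p hp e he hpe ⟨_, hTS p hp e he hpe, fun i j => ?_⟩
    refine (hTlim p hp e he hpe i j).congr' ?_
    filter_upwards [self_mem_nhdsWithin, nhdsWithin_le_nhds (e.open_source.mem_nhds hpe)]
      with x hx hxe
    have hy := CCC.mem_region hxe hx
    have h1 : CCC.comp2 Tm e i j (e x) = 0 := by
      unfold CCC.comp2
      rw [hTm _ hy.2]; rfl
    rw [hT e he _ hy, CCC.totalEMT, h1, add_zero]
    simp [CCC.comp0, e.left_inv hxe]
  · intro p hp e he hpe
    refine CCC.tendsto_size_atTop hε (hTS p hp e he hpe)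
      (fun i j => (hTlim p hp e he hpe i j).mono_left (nhdsWithin_mono p hUM))
      (B := fun _ _ _ => 0) (fun _ _ => tendsto_const_nhds) (hΦlim p hp) (hΦev p) ?_
    filter_upwards [hev e p hpe] with x ⟨hxe, hxU⟩ i j
    have hy := CCC.mem_region hxe hxU
    have h2 : CCC.comp0 φ e (e x) = φ x := by simp [CCC.comp0, e.left_inv hxe]
    have h3 : CCC.comp0 θ e (e x) = θ x := by simp [CCC.comp0, e.left_inv hxe]
    rw [hsol.scalarEMT_dualMetric he (htr e he) hy, hT e he _ (CCC.region_mono hUM hy), h2, h3,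
      hφΦ x hxU]
    ring
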